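/- Let $(I,\preceq)$ be a finite partially ordered set without isolated points (every $i\in I$ is comparable with some $j\ne i$). Let $\mathcal A=\prod_{i,j\in I}\mathcal A_{ij}$ be a Vinberg algebra over $I$. That is, the $\mathcal A_{ij}$ are finite-dimensional real vector spaces with $\mathcal A_{ii}=\mathbb R$, with $n_{ij}=\dim\mathcal A_{ij}>0$ if $i\ne j$ are comparable, and with $\mathcal A_{ij}=\{0\}$ if $i,j$ are incomparable. There are bilinear products $\mathcal A_{ij}\times\mathcal A_{jk}\to\mathcal A_{ik}$, for which the elements of $\mathcal A_{ii}=\mathbb R$ act as scalars on both sides, and linear involutions $\mathcal A_{ij}\to\mathcal A_{ji}$, equal to the identity on $\mathcal A_{ii}$. These define $AB$, $A^*$ and $\operatorname{tr}A=\sum_i a_{ii}$ as for matrices. With $\mathcal T_l=\{A:\ a_{ij}=0\text{ unless }j\preceq i\}$, the following hold: $\operatorname{tr}(AA^*)>0$ for $A\ne0$; $(AB)^*=B^*A^*$; $\operatorname{tr}(AB)=\operatorname{tr}(BA)$; $\operatorname{tr}(A(BC))=\operatorname{tr}((AB)C)$; and, for $S,T,U\in\mathcal T_l$, $(ST)U=S(TU)$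 and $T(UU^*)=(TU)U^*$. Let $\mathcal H=\{A:A^*=A\}$, let $\mathcal T_l^+$ be the set of elements of $\mathcal T_l$ with positive diagonal entries, $\mathcal P=\{TT^*:T\in\mathcal T_l^+\}$ and $\mathcal P^*=\{T^*T:T\in\mathcal T_l^+\}$. For $\theta=T^*T\in\mathcal P^*$ put $\theta^{-1}=T^{-1}(T^{-1})^*\in\mathcal P$, where $T^{-1}$ is the inverse in $\mathcal T_l^+$. For $\chi=(\lambda_i)_{i\in I}\in\mathbb R^I$ and $X=TT^*\in\mathcal P$ with $T=(t_{ij})\in\mathcal T_l^+$, let $$\Delta_\chi(X)=\prod_{k\in I}\Big(\frac{\prod_{j\preceq k}t_{jj}^2}{\prod_{j\prec k}t_{jj}^2}\Big)^{\lambda_k}.$$ For a positive measure $\mu$ on $\mathcal H$ and $\theta\in\mathcal H$ let $L_\mu(\theta)=\int e^{-\operatorname{tr}(\theta Z)}\,\mu(dZ)\in[0,\infty]$. Let $\wp$ be the set of $i\in I$ that have no element strictly below and some element strictly above them. Let $\mathcal S$ be the set of separators, i.e. of the $j\in I$ for which there are distinct $i_1,i_2\prec j$. For $i\in\wp\cup\mathcal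 S$ let $\varepsilon^i$ be the set of maps $\psi:I\to\{0,1\}$ with $\psi(j)=0$ for all $j\not\succeq i$ and, if $i\in\wp$, also for all $j\in\mathcal S$. Let $n_j^\psi=\sum_{k\prec j}\psi(k)n_{jk}$, and let $\Xi(i)$ be the set of all $(\lambda_j)_{j\in I}$ for which there is $\psi\in\varepsilon^i$ such that $\lambda_j=0$ if $j\not\succeq i$, $\lambda_j=n_j^\psi/2$ if $j\succeq i$ and $\psi(j)=0$, and $\lambda_j>n_j^\psi/2$ if $j\succeq i$ and $\psi(j)=1$. Put $\Xi=\sum_{i\in\wp\cup\mathcal S}\Xi(i)$ (Minkowski sum). **Theorem.** Let $\chi=(\lambda_i)_{i\in I}\in\Xi$. There is a positive measure $R_\chi$ on $\mathcal H$, the Riesz measure, such that $L_{R_\chi}(\theta)=\Delta_\chi(\theta^{-1})$ for all $\theta\in\mathcal P^*$. Every such measure $R_\chi$ generates a natural exponential family, that is, it is not concentrated on an affine hyperplane of $\mathcal H$ and $\{\theta\in\mathcal H: L_{R_\chi}(\theta)<\infty\}$ has non-empty interior, if and only if $\lambda_i\ne0$ for all $i\in\wp\cup\mathcal S$. -/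

import Mathlib

open MeasureTheory

/-- Matrices `(a_{ij})` indexed by `I × I`, the `(i, j)` entry lying in the real vector space
`A i j`. -/
abbrev BlockMatrix {I : Type*} (A : I → I → Type*) := ∀ i j, A i j

/-- The linear data of a Vinberg algebra over a finite poset `I`: the entry spaces are `ℝ` on the
diagonal, non-zero for comparable distinct indices and zero otherwise; `star` is the involution
`a_{ij} ↦ a_{ij}^* ∈ A j i` of the entries (identity on the diagonal) and `mul` are the bilinear
maps `A i j × A j k → A i k`, for which diagonal entries act as scalars (so that the matrix with
all diagonal entries `1` is the unit). -/
structure VinbergData (I : Type*) [PartialOrder I] (A : I → I → Type*)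
    [∀ i j, NormedAddCommGroup (A i j)] [∀ i j, NormedSpace ℝ (A i j)] where
  /-- the identification `A i i = ℝ` -/
  diag : ∀ i, A i i ≃ₗ[ℝ] ℝ
  finrank_pos : ∀ i j, j < i → 0 < Module.finrank ℝ (A i j)
  subsingleton : ∀ i j, ¬ i ≤ j → ¬ j ≤ i → Subsingleton (A i j)
  star : ∀ i j, A i j →ₗ[ℝ] A j i
  star_star : ∀ i j (a : A i j), star j i (star i j a) = a
  star_diag : ∀ i (a : A i i), star i i a = a
  mul : ∀ i j k, A i j →ₗ[ℝ] A j k →ₗ[ℝ] A i k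
  diag_mul : ∀ i j (a : A i i) (b : A i j), mul i i j a b = diag i a • b
  mul_diag : ∀ i j (b : A i j) (a : A j j), mul i j j b a = diag j a • b

namespace VinbergData

variable {I : Type*} [PartialOrder I] {A : I → I → Type*}
  [∀ i j, NormedAddCommGroup (A i j)] [∀ i j, NormedSpace ℝ (A i j)] (V : VinbergData I A)

/-- The trace. -/
def tr [Fintype I] (X : BlockMatrix A) : ℝ := ∑ i, V.diag i (X i i)

/-- The product of the algebra. -/
def prod [Fintype I] (X Y : BlockMatrix A) : BlockMatrix A :=
  fun i j => ∑ k, V.mul i k j (X i k) (Y k j)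

/-- The involution `X ↦ X^*` of the algebra. -/
def adj (X : BlockMatrix A) : BlockMatrix A := fun i j => V.star j i (X j i)

/-- The lower triangular matrices. -/
def Tl (_V : VinbergData I A) : Set (BlockMatrix A) := {X | ∀ i j, ¬ j ≤ i → X i j = 0}

/-- The lower triangular matrices with positive diagonal. -/
def TlPos : Set (BlockMatrix A) := {X | X ∈ V.Tl ∧ ∀ i, 0 < V.diag i (X i i)}

open Classical in
/-- The unit matrix. -/
noncomputable def one : BlockMatrix A :=
  fun i j => if h : i = j then h ▸ (V.diag i).symm 1 else 0

/-- The real vector space of Hermitian matrices, `X^* = X`. -/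
def hermitian : Submodule ℝ (BlockMatrix A) where
  carrier := {X | V.adj X = X}
  add_mem' := by
    intro X Y hX hY
    funext i j
    have h1 := congrFun (congrFun hX i) j
    have h2 := congrFun (congrFun hY i) j
    simp only [adj, Pi.add_apply, map_add] at *
    rw [h1, h2]
  zero_mem' := by
    funext i j
    simp [adj]
  smul_mem' := by
    intro c X hX
    funext i j
    have h1 := congrFun (congrFun hX i) j
    simp only [adj, Pi.smul_apply, map_smul] at *
    rw [h1]

end VinbergData

/-- A Vinberg algebra. -/
structure VinbergAlgebra (I : Type*) [PartialOrder I] [Fintype I] (A : I → I → Type*)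
    [∀ i j, NormedAddCommGroup (A i j)] [∀ i j, NormedSpace ℝ (A i j)]
    extends VinbergData I A where
  tr_self_pos : ∀ X : BlockMatrix A, X ≠ 0 →
    0 < toVinbergData.tr (toVinbergData.prod X (toVinbergData.adj X))
  adj_prod : ∀ X Y : BlockMatrix A, toVinbergData.adj (toVinbergData.prod X Y) =
    toVinbergData.prod (toVinbergData.adj Y) (toVinbergData.adj X)
  tr_comm : ∀ X Y : BlockMatrix A,
    toVinbergData.tr (toVinbergData.prod X Y) = toVinbergData.tr (toVinbergData.prod Y X)
  tr_assoc : ∀ X Y Z : BlockMatrix A,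
    toVinbergData.tr (toVinbergData.prod X (toVinbergData.prod Y Z)) =
      toVinbergData.tr (toVinbergData.prod (toVinbergData.prod X Y) Z)
  tri_assoc : ∀ S ∈ toVinbergData.Tl, ∀ T ∈ toVinbergData.Tl, ∀ U ∈ toVinbergData.Tl,
    toVinbergData.prod (toVinbergData.prod S T) U =
      toVinbergData.prod S (toVinbergData.prod T U)
  tri_assoc_adj : ∀ T ∈ toVinbergData.Tl, ∀ U ∈ toVinbergData.Tl,
    toVinbergData.prod T (toVinbergData.prod U (toVinbergData.adj U)) =
      toVinbergData.prod (toVinbergData.prod T U) (toVinbergData.adj U)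

/-- The minimal elements that are not maximal: nothing below, something above. -/
def initialSet (I : Type*) [PartialOrder I] : Set I :=
  {i | (∃ j, i < j) ∧ ¬ ∃ j, j < i}

/-- `j` separates the distinct elements `i₁` and `i₂` if it is above both and distinct from both;
the separators are the elements that separate some pair. -/
def separatorSet (I : Type*) [PartialOrder I] : Set I :=
  {j | ∃ i₁ i₂, i₁ ≠ i₂ ∧ i₁ ≤ j ∧ i₂ ≤ j ∧ j ≠ i₁ ∧ j ≠ i₂}

/-- For `i` in `initialSet I ∪ separatorSet I`: the maps `ψ : I → {0, 1}` that vanish off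
`{j | i ≤ j}` and, if `i` is in `initialSet I`, also on the separators. -/
def epsSet {I : Type*} [PartialOrder I] (i : I) : Set (I → Fin 2) :=
  {ψ | (∀ j, ¬ i ≤ j → ψ j = 0) ∧ (i ∈ initialSet I → ∀ j ∈ separatorSet I, ψ j = 0)}

namespace VinbergAlgebra

variable {I : Type*} [PartialOrder I] [Fintype I] {A : I → I → Type*}
  [∀ i j, NormedAddCommGroup (A i j)] [∀ i j, NormedSpace ℝ (A i j)] (V : VinbergAlgebra I A)

/-- The dual cone `{T^* T | T ∈ T_l^+}`, under the identification of the space of Hermitian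
matrices with its dual by `(X, Y) ↦ tr (X Y)`. -/
def dualCone : Set (BlockMatrix A) := {X | ∃ T ∈ V.TlPos, X = V.prod (V.adj T) T}

/-- For `X` in the homogeneous cone `{T T^* | T ∈ T_l^+}`, the unique `T ∈ T_l^+` with
`X = T T^*`. -/
noncomputable def triFactor (X : BlockMatrix A) : BlockMatrix A :=
  Classical.epsilon fun T => T ∈ V.TlPos ∧ X = V.prod T (V.adj T)

/-- For `θ = T^* T` in the dual cone, `T ∈ T_l^+`, the inverse `θ⁻¹ = T⁻¹ (T⁻¹)^*`, which lies in
the cone; here `T⁻¹` is the inverse in the group `T_l^+`. -/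
noncomputable def dualInv (θ : BlockMatrix A) : BlockMatrix A :=
  Classical.epsilon fun X => ∃ T ∈ V.TlPos, ∃ S ∈ V.TlPos,
    θ = V.prod (V.adj T) T ∧ V.prod S T = V.one ∧ V.prod T S = V.one ∧ X = V.prod S (V.adj S)

open Classical in
/-- The strict principal minor of order `k` of `X = T T^*`: the product of the `t_{jj}^2` over
`j < k`. -/
noncomputable def strictMinor (k : I) (X : BlockMatrix A) : ℝ :=
  ∏ j : I with j < k, V.diag j (V.triFactor X j j) ^ 2

open Classical in
/-- The large principal minor of order `k` of `X = T T^*`: the product of the `t_{jj}^2` over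
`j ≤ k`. -/
noncomputable def largeMinor (k : I) (X : BlockMatrix A) : ℝ :=
  ∏ j : I with j ≤ k, V.diag j (V.triFactor X j j) ^ 2

/-- The generalized power function of the multiplier `χ = (λ_k)`. -/
noncomputable def genPower (χ : I → ℝ) (X : BlockMatrix A) : ℝ :=
  ∏ k, (V.largeMinor k X / V.strictMinor k X) ^ χ k

open Classical in
/-- `n_j = ∑_{k < j} ψ(k) dim A_{jk}`. -/
noncomputable def nPsi (_V : VinbergAlgebra I A) (ψ : I → Fin 2) (j : I) : ℝ :=
  ∑ k : I with k < j, ((ψ k : ℕ) : ℝ) * (Module.finrank ℝ (A j k) : ℝ)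

/-- The set `Ξ(i, ψ)`. -/
def XiPsi (i : I) (ψ : I → Fin 2) : Set (I → ℝ) :=
  {χ | (∀ j, ¬ i ≤ j → χ j = 0) ∧ (∀ j, i ≤ j → ψ j = 0 → χ j = V.nPsi ψ j / 2) ∧
    (∀ j, i ≤ j → ψ j = 1 → V.nPsi ψ j / 2 < χ j)}

/-- The set `Ξ(i)`, the union of the `Ξ(i, ψ)`. -/
def XiAt (i : I) : Set (I → ℝ) := ⋃ ψ ∈ epsSet i, V.XiPsi i ψ

/-- The set `Ξ`: the Minkowski sum of the sets `Ξ(i)`, `i ∈ initialSet I ∪ separatorSet I`. -/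
def Xi : Set (I → ℝ) :=
  {χ | ∃ c : I → (I → ℝ), (∀ i ∈ initialSet I ∪ separatorSet I, c i ∈ V.XiAt i) ∧
    (∀ i ∉ initialSet I ∪ separatorSet I, c i = 0) ∧ χ = ∑ i, c i}

variable [∀ i j, MeasurableSpace (A i j)]

/-- The Laplace transform `L_μ(θ) = ∫ exp (-tr (θ Z)) μ(dZ)`, with values in `[0, ∞]`, of a measure
on the space of Hermitian matrices. -/
noncomputable def laplace (μ : Measure V.hermitian) (θ : BlockMatrix A) : ENNReal :=
  ∫⁻ Z, ENNReal.ofReal (Real.exp (-V.tr (V.prod θ Z))) ∂μ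

/-- `R` is the Riesz measure of `χ`: its Laplace transform is finite on the dual cone, where it
equals `θ ↦ Δ_χ(θ⁻¹)`. -/
def IsRieszMeasure (χ : I → ℝ) (R : Measure V.hermitian) : Prop :=
  ∀ θ ∈ V.dualCone, V.laplace R θ = ENNReal.ofReal (V.genPower χ (V.dualInv θ))

/-- `μ` generates a natural exponential family: it is not concentrated on an affine hyperplane of
the space of Hermitian matrices, and the interior of its Laplace domain is not empty. -/
def GeneratesNEF (μ : Measure V.hermitian) : Prop :=
  (∀ (f : V.hermitian →ₗ[ℝ] ℝ) (c : ℝ), f ≠ 0 → μ {Z | f Z ≠ c} ≠ 0) ∧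
    (interior {θ : V.hermitian | V.laplace μ θ < ⊤}).Nonempty

end VinbergAlgebra

/-!
The exponents in `Ξ` are sums of weights `columnWeight A k α`, so a Riesz measure is a convolution
of measures carried by the squares `u u^*` of single columns `u = (r, v)`. For `T ∈ T_l^+` one has
`tr (T^* T u u^*) = tr (T u (T u)^*)`, which is `t_{kk}^2 r^2` plus a positive definite quadratic
form in the entries of `T u` below the diagonal; integrating first over `v` gives the Jacobian
`∏ t_{jj} ^ (-n_{jk})` over `j > k`, then the measure `r ^ (2 α - 1) dr` gives the factor
`t_{kk} ^ (-2 α)`.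

That a measure lies on a hyperplane `tr (η Z) = c` can be read off its Laplace transform near the
unit, by the equality case of `2 ≤ e^x + e^{-x}`. So it is the same for all the Riesz measures of
one `χ`, and passes from a convolution to its factors. If `χ k ≠ 0` for every minimal `k`, each
minimal column occurs as a factor; the form `u ↦ f (u u^*)` is then constant almost everywhere,
hence zero by homogeneity, and the squares of the minimal columns span the Hermitian matrices. If
`χ i = 0`, the Laplace transform does not change in the direction of the `i`-th diagonal unit, and
the measure lies on a hyperplane.
-/

/-! ### Finite sums, determinants and quadratic forms -/

lemma apply_eq_of_sum_eq {ι M : Type*} [Fintype ι] [AddCommGroup M] {f g : ι → M} (j : ι)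
    (h : ∑ k, f k = ∑ k, g k) (hne : ∀ k ≠ j, f k = g k) : f j = g j := by
  rw [← sub_eq_zero, ← Finset.sum_sub_distrib,
    Fintype.sum_eq_single j fun k hk => sub_eq_zero.2 (hne k hk)] at h
  exact sub_eq_zero.1 h

@[to_additive]
lemma prod_univ_eq_mul_prod_gt {J M : Type*} [Fintype J] [PartialOrder J] [CommMonoid M]
    (k : J) [Fintype {j // k < j}] {g : J → M} (hg : ∀ j, ¬ k ≤ j → g j = 1) :
    ∏ j, g j = g k * ∏ j : {j // k < j}, g j := by
  classical
  rw [← Finset.prod_subtype ({j | k < j} : Finset J) (by simp) g,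
    ← Finset.prod_insert (by simp)]
  refine (Finset.prod_subset (Finset.subset_univ _) fun j _ hj => hg j fun h => hj ?_).symm
  simpa [eq_comm, le_iff_eq_or_lt] using h

lemma det_eq_prod_diag_of_isStrictOrder {R n : Type*} [CommRing R] [Fintype n] [DecidableEq n]
    (r : n → n → Prop) [IsStrictOrder n r] {M : Matrix n n R}
    (hM : ∀ p q, p ≠ q → ¬ r q p → M p q = 0) : M.det = ∏ p, M p p := by
  let _ : PartialOrder n := partialOrderOfSO r
  let o : LinearOrder n := (inferInstance : LinearOrder (LinearExtension n))
  convert @Matrix.det_of_isLowerTriangular n R _ _ _ o M fun p q hpq => ?_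
  have hlt : @LT.lt n o.toLT p q := hpq
  refine hM p q (@ne_of_lt n o.toPreorder p q hlt) fun hqp => ?_
  exact @not_le_of_gt n o.toPreorder p q hlt (toLinearExtension.monotone (Or.inr hqp))

lemma det_pi_of_lowerTriangular {R J : Type*} [CommRing R] [Nontrivial R] [Fintype J]
    [DecidableEq J] [PartialOrder J] {M : J → Type*} [∀ j, AddCommGroup (M j)]
    [∀ j, Module R (M j)] [∀ j, Module.Free R (M j)] [∀ j, Module.Finite R (M j)]
    (L : (∀ j, M j) →ₗ[R] ∀ j, M j) (d : J → R)
    (h : ∀ l (x : M l) j, ¬ l < j → L (Pi.single l x) j = d j • (Pi.single l x : ∀ j, M j) j) :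
    LinearMap.det L = ∏ j, d j ^ Module.finrank R (M j) := by
  let b := Pi.basis fun j => Module.finBasis R (M j)
  have hentry : ∀ p q, ¬ q.1 < p.1 →
      LinearMap.toMatrix b b L p q = if p = q then d p.1 else 0 := by
    intro p q hpq
    have hL : L (b q) p.1 = d p.1 • (b q) p.1 := by rw [Pi.basis_apply]; exact h _ _ _ hpq
    have hrepr : ∀ v, b.repr v p = (Module.finBasis R (M p.1)).repr (v p.1) p.2 :=
      fun v => Pi.basis_repr _ v p
    rw [LinearMap.toMatrix_apply, hrepr, hL, map_smul, Finsupp.smul_apply, ← hrepr,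
      b.repr_self, Finsupp.single_apply]
    simp [eq_comm]
  rw [← LinearMap.det_toMatrix b, det_eq_prod_diag_of_isStrictOrder (Sigma.fst ⁻¹'o (· < ·))
    fun p q hne hqp => by rw [hentry p q hqp, if_neg hne], Fintype.prod_sigma]
  simp [hentry]

section FiniteDimensional

variable {E : Type*} [NormedAddCommGroup E] [NormedSpace ℝ E] [FiniteDimensional ℝ E]

lemma continuous_quadraticMap {F : Type*} [NormedAddCommGroup F] [NormedSpace ℝ F]
    (Q : QuadraticMap ℝ E F) : Continuous Q := by
  let B := (QuadraticMap.associated (R := ℝ) Q).toContinuousBilinearMap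
  have h : ⇑Q = fun x => B x x :=
    funext fun x => (QuadraticMap.associated_eq_self_apply ℝ Q x).symm
  rw [h]
  fun_prop

lemma exists_mul_norm_sq_le_quadraticForm {Q : QuadraticForm ℝ E} (hQ : Q.PosDef) :
    ∃ c > 0, ∀ x, c * ‖x‖ ^ 2 ≤ Q x := by
  rcases subsingleton_or_nontrivial E with _ | _
  · exact ⟨1, one_pos, fun x => by simp [Subsingleton.elim x 0]⟩
  obtain ⟨y, hy, hmin⟩ := (isCompact_sphere (0 : E) 1).exists_isMinOn
    (NormedSpace.sphere_nonempty.2 zero_le_one) (continuous_quadraticMap Q).continuousOn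
  refine ⟨Q y, hQ y (ne_zero_of_mem_unit_sphere ⟨y, hy⟩), fun x => ?_⟩
  rcases eq_or_ne x 0 with rfl | hx
  · simp
  have h1 : Q y ≤ Q (‖x‖⁻¹ • x) := hmin (by simp [norm_smul, hx])
  rw [QuadraticMap.map_smul, smul_eq_mul] at h1
  calc Q y * ‖x‖ ^ 2 ≤ (‖x‖⁻¹ * ‖x‖⁻¹ * Q x) * ‖x‖ ^ 2 := by gcongr
    _ = Q x := by have := norm_ne_zero_iff.2 hx; field_simp

variable [MeasurableSpace E] [BorelSpace E] (μ : Measure E) [μ.IsAddHaarMeasure]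

lemma lintegral_exp_neg_quadraticForm_lt_top {Q : QuadraticForm ℝ E} (hQ : Q.PosDef) :
    ∫⁻ x, ENNReal.ofReal (Real.exp (-Q x)) ∂μ < ⊤ := by
  rcases subsingleton_or_nontrivial E with _ | _
  · exact (Integrable.of_finite (f := fun x => Real.exp (-Q x))).lintegral_lt_top
  obtain ⟨c, hc, hle⟩ := exists_mul_norm_sq_le_quadraticForm hQ
  have hint : Integrable (fun x : E => Real.exp (-c * ‖x‖ ^ 2)) μ := by
    refine (integrable_fun_norm_addHaar μ (f := fun r => Real.exp (-c * r ^ 2))).2 ?_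
    simpa using integrableOn_rpow_mul_exp_neg_mul_sq hc
      (s := ((Module.finrank ℝ E - 1 : ℕ) : ℝ)) (neg_one_lt_zero.trans_le (Nat.cast_nonneg _))
  refine (lintegral_mono fun x => ?_).trans_lt hint.lintegral_lt_top
  gcongr
  linarith [hle x]

lemma lintegral_comp_add_linearMap {f : E → ENNReal} (hf : Measurable f) (x : E)
    {L : E →ₗ[ℝ] E} (hL : LinearMap.det L ≠ 0) :
    ∫⁻ v, f (x + L v) ∂μ = ENNReal.ofReal |(LinearMap.det L)⁻¹| * ∫⁻ v, f v ∂μ := by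
  have hLm : Measurable L := (LinearMap.continuous_of_finiteDimensional L).measurable
  rw [← lintegral_map (f := fun w => f (x + w)) (by fun_prop) hLm,
    Measure.map_linearMap_addHaar_eq_smul_addHaar μ hL, lintegral_smul_measure,
    lintegral_add_left_eq_self, smul_eq_mul]

end FiniteDimensional

/-! ### The radial measure -/

/-- The measure `r ^ (2 α - 1) dr` on the positive half-line, under which `r²` has, up to a
constant, the Gamma distribution of parameter `α`. -/
noncomputable def radialMeasure (α : ℝ) : Measure ℝ :=
  (volume.restrict (Set.Ioi 0)).withDensity fun r => ENNReal.ofReal (r ^ (2 * α - 1))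

instance (α : ℝ) : SFinite (radialMeasure α) := by unfold radialMeasure; infer_instance

lemma lintegral_exp_neg_mul_sq_radialMeasure {α s : ℝ} (hα : 0 < α) (hs : 0 < s) :
    ∫⁻ r, ENNReal.ofReal (Real.exp (-(s * r ^ 2))) ∂radialMeasure α =
      ENNReal.ofReal (s ^ (-α)) * ENNReal.ofReal (Real.Gamma α / 2) := by
  have hint : IntegrableOn (fun r => r ^ (2 * α - 1) * Real.exp (-s * r ^ (2 : ℝ))) (Set.Ioi 0) :=
    integrableOn_rpow_mul_exp_neg_mul_rpow (by linarith) (by norm_num) hs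
  have hpos : ∀ r ∈ Set.Ioi (0 : ℝ), 0 ≤ r ^ (2 * α - 1) :=
    fun r hr => Real.rpow_nonneg (Set.mem_Ioi.1 hr).le _
  calc ∫⁻ r, ENNReal.ofReal (Real.exp (-(s * r ^ 2))) ∂radialMeasure α
      = ∫⁻ r in Set.Ioi 0, ENNReal.ofReal (r ^ (2 * α - 1) * Real.exp (-s * r ^ (2 : ℝ))) := by
        rw [radialMeasure, lintegral_withDensity_eq_lintegral_mul _ (by fun_prop) (by fun_prop)]
        refine setLIntegral_congr_fun measurableSet_Ioi fun r hr => ?_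
        simp [ENNReal.ofReal_mul (hpos r hr)]
    _ = ENNReal.ofReal (s ^ (-α) * (Real.Gamma α / 2)) := by
        rw [← ofReal_integral_eq_lintegral_ofReal hint, integral_rpow_mul_exp_neg_mul_rpow
          two_pos (by linarith) hs]
        · ring_nf
        · filter_upwards [self_mem_ae_restrict measurableSet_Ioi] with r hr
          exact mul_nonneg (hpos r hr) (Real.exp_pos _).le
    _ = _ := ENNReal.ofReal_mul (Real.rpow_nonneg hs.le _)

lemma restrict_Ioi_absolutelyContinuous_radialMeasure (α : ℝ) :
    volume.restrict (Set.Ioi (0 : ℝ)) ≪ radialMeasure α := by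
  refine withDensity_absolutelyContinuous' (by fun_prop) ?_
  filter_upwards [self_mem_ae_restrict measurableSet_Ioi] with r hr
  simpa using Real.rpow_pos_of_pos (Set.mem_Ioi.1 hr) (2 * α - 1)

section RadialProduct

variable {E : Type*} [NormedAddCommGroup E] [NormedSpace ℝ E] [FiniteDimensional ℝ E]
  [MeasurableSpace E]

lemma quadraticForm_eq_zero_of_ae_const_radialMeasure_prod (μ : Measure E) [μ.IsOpenPosMeasure]
    [SFinite μ] {α : ℝ} {Q : QuadraticForm ℝ (ℝ × E)} {b : ℝ}
    (h : ∀ᵐ p ∂(radialMeasure α).prod μ, Q p = b) : Q = 0 := by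
  have hcont : Continuous Q := continuous_quadraticMap Q
  have hopen : ∀ p : ℝ × E, 0 < p.1 → Q p = b := by
    have hU : ∀ᵐ p ∂((volume : Measure ℝ).prod μ).restrict (Set.Ioi 0 ×ˢ Set.univ), Q p = b := by
      rw [← Measure.prod_restrict, Measure.restrict_univ]
      exact ((restrict_Ioi_absolutelyContinuous_radialMeasure α).prod .rfl).ae_le h
    intro p hp
    exact Measure.eqOn_open_of_ae_eq hU (isOpen_Ioi.prod isOpen_univ) hcont.continuousOn
      continuousOn_const ⟨hp, trivial⟩
  have hzero : ∀ p : ℝ × E, 0 < p.1 → Q p = 0 := by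
    intro p hp
    have h2 : Q ((2 : ℝ) • p) = b := hopen _ (by simpa using hp)
    rw [QuadraticMap.map_smul, hopen p hp, smul_eq_mul] at h2
    rw [hopen p hp]
    linarith
  have hne : ∀ p : ℝ × E, p.1 ≠ 0 → Q p = 0 := by
    intro p hp
    rcases hp.lt_or_gt with hp | hp
    · rw [← QuadraticMap.map_neg]
      exact hzero _ (by simpa using hp)
    · exact hzero p hp
  have hdense : Dense {p : ℝ × E | p.1 ≠ 0} := by
    have : {p : ℝ × E | p.1 ≠ 0} = {(0 : ℝ)}ᶜ ×ˢ Set.univ := by ext; simp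
    rw [this]
    exact (dense_compl_singleton 0).prod dense_univ
  exact DFunLike.coe_injective (hcont.ext_on hdense continuous_const hne)

variable [BorelSpace E]

lemma lintegral_radialMeasure_prod (μ : Measure E) [μ.IsAddHaarMeasure] {g : E → ENNReal}
    (hg : Measurable g) {α s : ℝ} (hα : 0 < α) (hs : 0 < s) (x : E) {L : E →ₗ[ℝ] E}
    (hL : LinearMap.det L ≠ 0) :
    ∫⁻ p, ENNReal.ofReal (Real.exp (-(s * p.1 ^ 2))) * g (p.1 • x + L p.2)
        ∂(radialMeasure α).prod μ =
      ENNReal.ofReal (s ^ (-α)) * ENNReal.ofReal |(LinearMap.det L)⁻¹| *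
        (ENNReal.ofReal (Real.Gamma α / 2) * ∫⁻ v, g v ∂μ) := by
  have hLm : Measurable L := (LinearMap.continuous_of_finiteDimensional L).measurable
  rw [lintegral_prod _ (by fun_prop)]
  dsimp only
  simp_rw [lintegral_const_mul' _ _ ENNReal.ofReal_ne_top,
    lintegral_comp_add_linearMap μ hg _ hL]
  rw [lintegral_mul_const _ (by fun_prop), lintegral_exp_neg_mul_sq_radialMeasure hα hs]
  ring

end RadialProduct

/-! ### Laplace transforms and affine hyperplanes -/

lemma ae_eq_zero_of_lintegral_exp_add_sub {α : Type*} [MeasurableSpace α] {μ : Measure α}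
    {f g : α → ℝ} (hf : Measurable f) (hg : Measurable g)
    (hfin : ∫⁻ x, ENNReal.ofReal (Real.exp (g x)) ∂μ ≠ ⊤)
    (hadd : ∫⁻ x, ENNReal.ofReal (Real.exp (g x + f x)) ∂μ =
      ∫⁻ x, ENNReal.ofReal (Real.exp (g x)) ∂μ)
    (hsub : ∫⁻ x, ENNReal.ofReal (Real.exp (g x - f x)) ∂μ =
      ∫⁻ x, ENNReal.ofReal (Real.exp (g x)) ∂μ) :
    ∀ᵐ x ∂μ, f x = 0 := by
  have hfactor : ∀ x, ENNReal.ofReal (Real.exp (g x + f x)) + ENNReal.ofReal (Real.exp (g x - f x))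
      = ENNReal.ofReal (Real.exp (g x) * (Real.exp (f x) + Real.exp (-f x))) := by
    intro x
    rw [← ENNReal.ofReal_add (Real.exp_pos _).le (Real.exp_pos _).le, mul_add, ← Real.exp_add,
      ← Real.exp_add, sub_eq_add_neg]
  have htwo : ∀ x, 2 * ENNReal.ofReal (Real.exp (g x)) = ENNReal.ofReal (Real.exp (g x) * 2) := by
    intro x
    rw [mul_comm, ENNReal.ofReal_mul (Real.exp_pos _).le, ENNReal.ofReal_ofNat]
  have hle : ∀ x, 2 * ENNReal.ofReal (Real.exp (g x)) ≤
      ENNReal.ofReal (Real.exp (g x + f x)) + ENNReal.ofReal (Real.exp (g x - f x)) := by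
    intro x
    rw [hfactor, htwo]
    gcongr
    linarith [Real.add_one_le_exp (f x), Real.add_one_le_exp (-f x)]
  have heq := ae_eq_of_ae_le_of_lintegral_le (Filter.Eventually.of_forall hle)
    (by rw [lintegral_const_mul _ (by fun_prop)]; finiteness) (by fun_prop)
    (by rw [lintegral_add_left (by fun_prop), hadd, hsub, lintegral_const_mul _ (by fun_prop),
      two_mul])
  filter_upwards [heq] with x hx
  by_contra hne
  have hlt : 2 < Real.exp (f x) + Real.exp (-f x) := by
    linarith [Real.add_one_lt_exp hne, Real.add_one_lt_exp (neg_ne_zero.2 hne)]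
  rw [hfactor, htwo, ENNReal.ofReal_eq_ofReal_iff (by positivity) (by positivity)] at hx
  exact hlt.ne (mul_left_cancel₀ (Real.exp_pos _).ne' hx)

lemma exists_ae_eq_const_of_ae_conv {M : Type*} [AddCommMonoid M] [MeasurableSpace M]
    [MeasurableAdd₂ M] {μ ν : Measure M} [SFinite μ] [SFinite ν] (hν : ν ≠ 0) {f : M →+ ℝ}
    (hf : Measurable f) {c : ℝ} (h : ∀ᵐ x ∂(μ ∗ ν), f x = c) : ∃ b, ∀ᵐ x ∂μ, f x = b := by
  rw [Measure.conv_comm, Measure.conv,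
    ae_map_iff (by fun_prop) (measurableSet_eq_fun hf measurable_const)] at h
  have := ae_neBot.2 hν
  obtain ⟨y, hy⟩ := (Measure.ae_ae_of_ae_prod h).exists
  refine ⟨c - f y, hy.mono fun x hx => ?_⟩
  rw [← hx, map_add, add_sub_cancel_left]

/-! ### Triangular matrices -/

open Classical in
/-- The matrix whose only non-zero entry is `a`, in position `(i, j)`. -/
noncomputable def BlockMatrix.single {I : Type*} (A : I → I → Type*)
    [∀ i j, AddCommGroup (A i j)] [∀ i j, Module ℝ (A i j)] (i j : I) :
    A i j →ₗ[ℝ] BlockMatrix A :=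
  LinearMap.single ℝ (fun p => ∀ q, A p q) i ∘ₗ LinearMap.single ℝ (A i) j

namespace BlockMatrix

variable {I : Type*} {A : I → I → Type*} [∀ i j, AddCommGroup (A i j)] [∀ i j, Module ℝ (A i j)]

@[simp]
lemma single_apply_same (i j : I) (a : A i j) : single A i j a i j = a := by simp [single]

lemma single_apply_of_row_ne {i p : I} (h : p ≠ i) (j q : I) (a : A i j) :
    single A i j a p q = 0 := by
  simp [single, h]

lemma single_apply_of_col_ne {j q : I} (h : q ≠ j) (i p : I) (a : A i j) :
    single A i j a p q = 0 := by
  rcases eq_or_ne p i with rfl | hp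
  · simp [single, h]
  · exact single_apply_of_row_ne hp _ _ _

lemma sum_single [Fintype I] (X : BlockMatrix A) : ∑ i, ∑ j, single A i j (X i j) = X := by
  funext p q
  simp only [Finset.sum_apply]
  rw [Fintype.sum_eq_single p fun i hi => Finset.sum_eq_zero fun j _ =>
      single_apply_of_row_ne hi.symm _ _ _,
    Fintype.sum_eq_single q fun j hj => single_apply_of_col_ne hj.symm _ _ _, single_apply_same]

end BlockMatrix

namespace VinbergData

open BlockMatrix (single single_apply_same single_apply_of_row_ne single_apply_of_col_ne)

variable {I : Type*} [PartialOrder I] {A : I → I → Type*}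
  [∀ i j, NormedAddCommGroup (A i j)] [∀ i j, NormedSpace ℝ (A i j)] (V : VinbergData I A)

/-- The involution as a linear map. -/
def adjₗ : BlockMatrix A →ₗ[ℝ] BlockMatrix A where
  toFun := V.adj
  map_add' X Y := by funext i j; simp [adj]
  map_smul' c X := by funext i j; simp [adj]

@[simp]
lemma adjₗ_apply (X : BlockMatrix A) : V.adjₗ X = V.adj X := rfl

@[simp]
lemma adj_adj (X : BlockMatrix A) : V.adj (V.adj X) = X := by
  funext i j
  simp [adj, V.star_star]

lemma adj_add (X Y : BlockMatrix A) : V.adj (X + Y) = V.adj X + V.adj Y := map_add V.adjₗ X Y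

lemma mem_hermitian {X : BlockMatrix A} : X ∈ V.hermitian ↔ V.adj X = X := Iff.rfl

lemma adj_single (i j : I) (a : A i j) :
    V.adj (single A i j a) = single A j i (V.star i j a) := by
  funext p q
  unfold adj
  rcases eq_or_ne p j with rfl | hp
  · rcases eq_or_ne q i with rfl | hq
    · simp
    · rw [single_apply_of_row_ne hq, single_apply_of_col_ne hq, map_zero]
  · rw [single_apply_of_col_ne hp, single_apply_of_row_ne hp, map_zero]

/-- The space of lower triangular matrices. -/
def lowerTri : Submodule ℝ (BlockMatrix A) where
  carrier := V.Tl
  add_mem' hX hY i j h := by simp [hX i j h, hY i j h]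
  zero_mem' i j _ := rfl
  smul_mem' c X hX i j h := by simp [hX i j h]

lemma single_mem_Tl {i j : I} (h : j ≤ i) (a : A i j) : single A i j a ∈ V.Tl := by
  intro p q hpq
  rcases eq_or_ne p i with rfl | hp
  · exact single_apply_of_col_ne (by rintro rfl; exact hpq h) _ _ _
  · exact single_apply_of_row_ne hp _ _ _

lemma one_apply_self (i : I) : V.one i i = (V.diag i).symm 1 := by simp [one]

lemma one_apply_of_ne {i j : I} (h : i ≠ j) : V.one i j = 0 := by simp [one, h]

lemma one_mem_TlPos : V.one ∈ V.TlPos :=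
  ⟨fun _ _ h => V.one_apply_of_ne fun hij => h hij.ge, fun i => by simp [one_apply_self]⟩

@[simp]
lemma adj_one : V.adj V.one = V.one := by
  funext i j
  unfold adj
  rcases eq_or_ne i j with rfl | h
  · simp [V.star_diag]
  · rw [V.one_apply_of_ne h, V.one_apply_of_ne h.symm, map_zero]

lemma one_mem_hermitian : V.one ∈ V.hermitian := V.adj_one

/-- The squared length `a a^*` of an entry. -/
def entrySq (i j : I) : QuadraticForm ℝ (A i j) :=
  LinearMap.BilinMap.toQuadraticMap
    (((V.mul i j i).compl₂ (V.star i j)).compr₂ (V.diag i).toLinearMap)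

lemma entrySq_apply (i j : I) (a : A i j) :
    V.entrySq i j a = V.diag i (V.mul i j i a (V.star i j a)) := rfl

lemma entrySq_diag (i : I) (a : A i i) : V.entrySq i i a = V.diag i a ^ 2 := by
  simp [entrySq_apply, V.star_diag, V.diag_mul, pow_two]

/-- The projection `X ↦ (X + X^*) / 2` onto the Hermitian matrices. -/
noncomputable def hermPart : BlockMatrix A →ₗ[ℝ] V.hermitian :=
  ((1 / 2 : ℝ) • (LinearMap.id + V.adjₗ)).codRestrict V.hermitian fun X =>
    V.hermitian.smul_mem _ <| by
      simp only [LinearMap.add_apply, LinearMap.id_apply, adjₗ_apply, mem_hermitian, adj_add,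
        adj_adj, add_comm]

lemma coe_hermPart (X : BlockMatrix A) :
    (V.hermPart X : BlockMatrix A) = (1 / 2 : ℝ) • (X + V.adj X) := rfl

lemma hermPart_of_mem {X : BlockMatrix A} (hX : X ∈ V.hermitian) : V.hermPart X = ⟨X, hX⟩ := by
  ext1
  rw [coe_hermPart, V.mem_hermitian.1 hX, ← two_smul ℝ, smul_smul]
  norm_num

lemma hermPart_adj (X : BlockMatrix A) : V.hermPart (V.adj X) = V.hermPart X := by
  ext1
  rw [coe_hermPart, coe_hermPart, adj_adj, add_comm]

lemma exists_lowerTri_add_adj {H : BlockMatrix A} (hH : H ∈ V.hermitian) :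
    ∃ T ∈ V.Tl, T + V.adj T = H := by
  classical
  have hstar : ∀ i j, V.star j i (H j i) = H i j := fun i j => congrFun (congrFun hH i) j
  refine ⟨fun i j => if j < i then H i j else if i = j then (1 / 2 : ℝ) • H i j else 0,
    fun i j hij => ?_, ?_⟩
  · simp [mt le_of_lt hij, mt ge_of_eq hij]
  · funext i j
    simp only [Pi.add_apply, adj]
    by_cases hji : j < i
    · simp [hji, hji.not_gt, hji.ne]
    rcases eq_or_ne i j with rfl | hne
    · norm_num [hstar, ← add_smul]
    by_cases hij : i < j
    · simp [hji, hne, hij, hstar]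
    · have := V.subsingleton i j (fun h => hij (h.lt_of_ne hne)) fun h => hji (h.lt_of_ne hne.symm)
      exact Subsingleton.elim _ _

section Product

variable [Fintype I]

/-- The product as a bilinear map. -/
def prodₗ : BlockMatrix A →ₗ[ℝ] BlockMatrix A →ₗ[ℝ] BlockMatrix A :=
  LinearMap.mk₂ ℝ V.prod
    (fun X Y Z => by funext i j; simp [prod, Finset.sum_add_distrib])
    (fun c X Y => by funext i j; simp [prod, Finset.smul_sum])
    (fun X Y Z => by funext i j; simp [prod, Finset.sum_add_distrib])
    (fun c X Y => by funext i j; simp [prod, Finset.smul_sum])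

@[simp]
lemma prodₗ_apply (X Y : BlockMatrix A) : V.prodₗ X Y = V.prod X Y := rfl

/-- The trace as a linear form. -/
def trₗ : BlockMatrix A →ₗ[ℝ] ℝ where
  toFun := V.tr
  map_add' X Y := by simp [tr, Finset.sum_add_distrib]
  map_smul' c X := by simp [tr, Finset.mul_sum]

lemma add_prod (X Y Z : BlockMatrix A) : V.prod (X + Y) Z = V.prod X Z + V.prod Y Z :=
  V.prodₗ.map_add₂ X Y Z

lemma prod_add (X Y Z : BlockMatrix A) : V.prod X (Y + Z) = V.prod X Y + V.prod X Z :=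
  map_add (V.prodₗ X) Y Z

@[simp]
lemma one_prod (X : BlockMatrix A) : V.prod V.one X = X := by
  funext i j
  unfold prod
  rw [Fintype.sum_eq_single i fun k hk => by simp [V.one_apply_of_ne hk.symm]]
  simp [one_apply_self, V.diag_mul]

@[simp]
lemma prod_one (X : BlockMatrix A) : V.prod X V.one = X := by
  funext i j
  unfold prod
  rw [Fintype.sum_eq_single j fun k hk => by simp [V.one_apply_of_ne hk]]
  simp [one_apply_self, V.mul_diag]

lemma prod_mem_Tl {S T : BlockMatrix A} (hS : S ∈ V.Tl) (hT : T ∈ V.Tl) : V.prod S T ∈ V.Tl := by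
  intro i j hij
  refine Finset.sum_eq_zero fun k _ => ?_
  by_cases hk : k ≤ i
  · rw [hT k j fun h => hij (h.trans hk), map_zero]
  · rw [hS i k hk, map_zero, LinearMap.zero_apply]

lemma diag_prod {S T : BlockMatrix A} (hS : S ∈ V.Tl) (hT : T ∈ V.Tl) (i : I) :
    V.diag i (V.prod S T i i) = V.diag i (S i i) * V.diag i (T i i) := by
  unfold prod
  rw [Fintype.sum_eq_single i fun k hk => ?_]
  · simp [V.diag_mul]
  · by_cases h : k ≤ i
    · rw [hT k i fun h' => hk (le_antisymm h h'), map_zero]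
    · rw [hS i k h, map_zero, LinearMap.zero_apply]

lemma single_prod_single (i j k : I) (a : A i j) (b : A j k) :
    V.prod (single A i j a) (single A j k b) = single A i k (V.mul i j k a b) := by
  funext p q
  unfold prod
  rw [Fintype.sum_eq_single j fun m hm => by
    rw [single_apply_of_col_ne hm, map_zero, LinearMap.zero_apply]]
  rcases eq_or_ne p i with rfl | hp
  · rcases eq_or_ne q k with rfl | hq
    · simp
    · rw [single_apply_of_col_ne hq, single_apply_of_col_ne hq, map_zero]
  · rw [single_apply_of_row_ne hp, single_apply_of_row_ne hp, map_zero, LinearMap.zero_apply]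

lemma tr_single (i : I) (a : A i i) : V.tr (single A i i a) = V.diag i a := by
  unfold tr
  rw [Fintype.sum_eq_single i fun k hk => by rw [single_apply_of_row_ne hk, map_zero],
    single_apply_same]

lemma tr_prod_adj (X : BlockMatrix A) :
    V.tr (V.prod X (V.adj X)) = ∑ i, ∑ j, V.entrySq i j (X i j) := by
  simp [tr, prod, adj, entrySq_apply]

lemma eq_zero_of_prod_eq_zero {S T : BlockMatrix A} (hT : T ∈ V.TlPos)
    (h : V.prod S T = 0) : S = 0 := by
  suffices ∀ j i, S i j = 0 from funext fun i => funext fun j => this j i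
  intro j
  induction j using WellFoundedGT.induction with
  | ind j ih =>
    intro i
    have hij : V.prod S T i j = V.diag j (T j j) • S i j := by
      rw [← V.mul_diag]
      refine Fintype.sum_eq_single j fun k hk => ?_
      by_cases hjk : j ≤ k
      · rw [ih k (hjk.lt_of_ne hk.symm), map_zero, LinearMap.zero_apply]
      · rw [hT.1 k j hjk, map_zero]
    rw [h] at hij
    exact (smul_eq_zero.1 hij.symm).resolve_left (hT.2 j).ne'

lemma eq_of_prod_eq_prod {S S' T : BlockMatrix A} (hT : T ∈ V.TlPos)
    (h : V.prod S T = V.prod S' T) : S = S' :=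
  sub_eq_zero.1 <| V.eq_zero_of_prod_eq_zero hT <|
    (V.prodₗ.map_sub₂ S S' T).trans (sub_eq_zero.2 h)

end Product

end VinbergData

section Factorization

variable {I : Type*} [PartialOrder I] [Fintype I] {A : I → I → Type*}
  [∀ i j, NormedAddCommGroup (A i j)] [∀ i j, NormedSpace ℝ (A i j)]

namespace VinbergData

variable (V : VinbergData I A)

lemma eq_of_prod_adj_eq {S T : BlockMatrix A} (hS : S ∈ V.TlPos) (hT : T ∈ V.TlPos)
    (h : V.prod S (V.adj S) = V.prod T (V.adj T)) : S = T := by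
  suffices ∀ j i, S i j = T i j from funext fun i => funext fun j => this j i
  intro j
  induction j using WellFoundedLT.induction with
  | ind j ih =>
    have hcol : ∀ i, V.diag j (S j j) • S i j = V.diag j (T j j) • T i j := by
      intro i
      have hij := apply_eq_of_sum_eq j (congrFun (congrFun h i) j) fun k hk => by
        by_cases hkj : k ≤ j
        · simp only [adj, ih k (hkj.lt_of_ne hk)]
        · simp only [adj, hS.1 j k hkj, hT.1 j k hkj, map_zero]
      simpa [adj, V.star_diag, V.mul_diag] using hij
    have hdiag : V.diag j (S j j) = V.diag j (T j j) := by
      have hsq := congrArg (V.diag j) (hcol j)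
      rw [map_smul, map_smul] at hsq
      exact (mul_self_inj (hS.2 j).le (hT.2 j).le).1 hsq
    exact fun i => smul_right_injective _ (hT.2 j).ne' (hdiag ▸ hcol i)

lemma eq_of_adj_prod_eq {S T : BlockMatrix A} (hS : S ∈ V.TlPos) (hT : T ∈ V.TlPos)
    (h : V.prod (V.adj S) S = V.prod (V.adj T) T) : S = T := by
  suffices ∀ i j, S i j = T i j from funext fun i => funext fun j => this i j
  intro i
  induction i using WellFoundedGT.induction with
  | ind i ih =>
    have hrow : ∀ j, V.diag i (S i i) • S i j = V.diag i (T i i) • T i j := by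
      intro j
      have hij := apply_eq_of_sum_eq i (congrFun (congrFun h i) j) fun k hk => by
        by_cases hik : i ≤ k
        · simp only [adj, ih k (hik.lt_of_ne hk.symm)]
        · simp only [adj, hS.1 k i hik, hT.1 k i hik, map_zero, LinearMap.zero_apply]
      simpa [adj, V.star_diag, V.diag_mul] using hij
    have hdiag : V.diag i (S i i) = V.diag i (T i i) := by
      have hsq := congrArg (V.diag i) (hrow i)
      rw [map_smul, map_smul] at hsq
      exact (mul_self_inj (hS.2 i).le (hT.2 i).le).1 hsq
    exact fun j => smul_right_injective _ (hT.2 i).ne' (hdiag ▸ hrow j)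

lemma exists_prod_eq_one [∀ i j, FiniteDimensional ℝ (A i j)] {T : BlockMatrix A}
    (hT : T ∈ V.TlPos) : ∃ S ∈ V.TlPos, V.prod S T = V.one := by
  let mulRight : V.lowerTri →ₗ[ℝ] V.lowerTri :=
    (V.prodₗ.flip T).restrict fun _ hS => V.prod_mem_Tl hS hT.1
  have hinj : Function.Injective mulRight :=
    (injective_iff_map_eq_zero _).2 fun S hS =>
      Subtype.ext (V.eq_zero_of_prod_eq_zero hT (congrArg Subtype.val hS))
  obtain ⟨⟨S, hS⟩, hST⟩ := LinearMap.surjective_of_injective hinj ⟨V.one, V.one_mem_TlPos.1⟩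
  replace hST : V.prod S T = V.one := congrArg Subtype.val hST
  refine ⟨S, ⟨hS, fun i => ?_⟩, hST⟩
  have hdiag := V.diag_prod hS hT.1 i
  rw [hST, V.one_apply_self, LinearEquiv.apply_symm_apply] at hdiag
  exact pos_of_mul_pos_left (hdiag ▸ one_pos) (hT.2 i).le

end VinbergData

namespace VinbergAlgebra

open BlockMatrix (single single_apply_same)

variable (V : VinbergAlgebra I A)

lemma prod_adj_mem_hermitian (X : BlockMatrix A) : V.prod X (V.adj X) ∈ V.hermitian := by
  rw [V.mem_hermitian, V.adj_prod, V.adj_adj]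

lemma adj_prod_mem_hermitian (X : BlockMatrix A) : V.prod (V.adj X) X ∈ V.hermitian := by
  rw [V.mem_hermitian, V.adj_prod, V.adj_adj]

lemma entrySq_posDef (i j : I) : (V.entrySq i j).PosDef := by
  intro a ha
  have h := V.tr_self_pos (single A i j a) fun h => ha <| by
    rw [← single_apply_same i j a, h]; rfl
  rwa [V.adj_single, V.single_prod_single, V.tr_single] at h

lemma mul_mul_star {j l k : I} (hlj : l ≤ j) (hkl : k ≤ l) (a : A j l) (v : A l k) :
    V.mul j k l (V.mul j l k a v) (V.star l k v) = V.entrySq l k v • a := by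
  have h := V.tri_assoc_adj _ (V.single_mem_Tl hlj a) _ (V.single_mem_Tl hkl v)
  simp only [V.adj_single, V.single_prod_single] at h
  have hjl := congrFun (congrFun h j) l
  rw [single_apply_same, single_apply_same, V.mul_diag] at hjl
  exact hjl.symm

lemma tr_adj_prod_prod {T U : BlockMatrix A} (hT : T ∈ V.Tl) (hU : U ∈ V.Tl) :
    V.tr (V.prod (V.prod (V.adj T) T) (V.prod U (V.adj U))) =
      V.tr (V.prod (V.prod T U) (V.adj (V.prod T U))) := by
  rw [← V.tr_assoc, V.tri_assoc_adj T hT U hU, V.tr_comm, ← V.tr_assoc, V.adj_prod]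

lemma exists_inverse [∀ i j, FiniteDimensional ℝ (A i j)] {T : BlockMatrix A} (hT : T ∈ V.TlPos) :
    ∃ S ∈ V.TlPos, V.prod S T = V.one ∧ V.prod T S = V.one := by
  obtain ⟨S, hS, hST⟩ := V.exists_prod_eq_one hT
  refine ⟨S, hS, hST, V.eq_of_prod_eq_prod hT ?_⟩
  rw [V.tri_assoc T hT.1 S hS.1 T hT.1, hST, V.prod_one, V.one_prod]

lemma genPower_prod_adj (χ : I → ℝ) {S : BlockMatrix A} (hS : S ∈ V.TlPos) :
    V.genPower χ (V.prod S (V.adj S)) = ∏ k, (V.diag k (S k k) ^ 2) ^ χ k := by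
  classical
  have hfactor : V.triFactor (V.prod S (V.adj S)) = S := by
    have h := Classical.epsilon_spec
      (p := fun T => T ∈ V.TlPos ∧ V.prod S (V.adj S) = V.prod T (V.adj T)) ⟨S, hS, rfl⟩
    exact (V.eq_of_prod_adj_eq hS h.1 h.2).symm
  refine Finset.prod_congr rfl fun k _ => ?_
  have hle : ({j | j ≤ k} : Finset I) = insert k ({j | j < k} : Finset I) := by
    ext j; simp [le_iff_eq_or_lt]
  have hne : V.strictMinor k (V.prod S (V.adj S)) ≠ 0 := by
    rw [strictMinor, hfactor]
    exact Finset.prod_ne_zero_iff.2 fun j _ => pow_ne_zero 2 (hS.2 j).ne'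
  congr 1
  rw [div_eq_iff hne, largeMinor, strictMinor, hfactor, hle, Finset.prod_insert (by simp)]

lemma genPower_dualInv [∀ i j, FiniteDimensional ℝ (A i j)] (χ : I → ℝ) {T : BlockMatrix A}
    (hT : T ∈ V.TlPos) :
    V.genPower χ (V.dualInv (V.prod (V.adj T) T)) = ∏ k, (V.diag k (T k k) ^ 2) ^ (-χ k) := by
  obtain ⟨S, hS, hST, hTS⟩ := V.exists_inverse hT
  obtain ⟨T', hT', S', hS', hTT', hST', -, hinv⟩ := Classical.epsilon_spec
    (p := fun X => ∃ T' ∈ V.TlPos, ∃ S ∈ V.TlPos, V.prod (V.adj T) T = V.prod (V.adj T') T' ∧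
      V.prod S T' = V.one ∧ V.prod T' S = V.one ∧ X = V.prod S (V.adj S))
    ⟨_, T, hT, S, hS, rfl, hST, hTS, rfl⟩
  change V.dualInv (V.prod (V.adj T) T) = _ at hinv
  obtain rfl := V.eq_of_adj_prod_eq hT hT' hTT'
  rw [hinv, V.genPower_prod_adj χ hS']
  refine Finset.prod_congr rfl fun k _ => ?_
  have hdiag := V.diag_prod hS'.1 hT.1 k
  rw [hST', V.one_apply_self, LinearEquiv.apply_symm_apply] at hdiag
  rw [eq_inv_of_mul_eq_one_left hdiag.symm, inv_pow, Real.inv_rpow (sq_nonneg _),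
    Real.rpow_neg (sq_nonneg _)]

end VinbergAlgebra

end Factorization

/-! ### Columns -/

section Columns

open BlockMatrix (single single_apply_same single_apply_of_row_ne single_apply_of_col_ne)

/-- The entries strictly below the diagonal in the `k`-th column. -/
abbrev BlockMatrix.Below {I : Type*} [PartialOrder I] (A : I → I → Type*) (k : I) :=
  ∀ j : {j // k < j}, A j k

variable {I : Type*} [PartialOrder I] [Fintype I] {A : I → I → Type*}
  [∀ i j, NormedAddCommGroup (A i j)] [∀ i j, NormedSpace ℝ (A i j)]

namespace VinbergData

variable (V : VinbergData I A) (k : I) (p : ℝ × BlockMatrix.Below A k)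

open Classical in
/-- The lower triangular matrix whose only non-zero column is the `k`-th, with diagonal entry `p.1`
and entries `p.2` below it. -/
noncomputable def column : (ℝ × BlockMatrix.Below A k) →ₗ[ℝ] BlockMatrix A :=
  (single A k k ∘ₗ (V.diag k).symm.toLinearMap).coprod
    (∑ j : {j // k < j}, single A j k ∘ₗ LinearMap.proj j)

open Classical in
lemma column_apply :
    V.column k p = single A k k ((V.diag k).symm p.1) + ∑ j, single A j.1 k (p.2 j) := by
  simp [column]

lemma column_mem_Tl : V.column k p ∈ V.Tl := by
  rw [column_apply]
  exact V.lowerTri.add_mem (V.single_mem_Tl le_rfl _)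
    (V.lowerTri.sum_mem fun j _ => V.single_mem_Tl j.2.le _)

@[simp]
lemma column_apply_self : V.column k p k k = (V.diag k).symm p.1 := by
  simp only [column_apply, Pi.add_apply, Finset.sum_apply, single_apply_same, add_eq_left]
  exact Finset.sum_eq_zero fun j _ => single_apply_of_row_ne j.2.ne _ _ _

@[simp]
lemma column_apply_below (j : {j // k < j}) : V.column k p j k = p.2 j := by
  classical
  simp only [column_apply, Pi.add_apply, Finset.sum_apply, single_apply_of_row_ne j.2.ne', zero_add]
  rw [Fintype.sum_eq_single j fun l hl =>
    single_apply_of_row_ne (Subtype.coe_ne_coe.2 hl.symm) _ _ _, single_apply_same]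

lemma column_apply_of_ne {l : I} (h : l ≠ k) (i : I) : V.column k p i l = 0 := by
  simp [column_apply, single_apply_of_col_ne h]

variable {k}

lemma column_eq {X : BlockMatrix A} (hX : X ∈ V.Tl) (hcol : ∀ l ≠ k, ∀ i, X i l = 0) :
    V.column k (V.diag k (X k k), fun j => X j k) = X := by
  funext i l
  rcases eq_or_ne l k with rfl | hl
  · by_cases hli : l ≤ i
    · rcases hli.eq_or_lt with rfl | hlt
      · simp
      · exact V.column_apply_below l _ ⟨i, hlt⟩
    · rw [V.column_mem_Tl l _ i l hli, hX i l hli]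
  · rw [V.column_apply_of_ne k _ hl, hcol l hl]

lemma exists_column_eq_single {j : I} (h : k ≤ j) (a : A j k) :
    ∃ p, V.column k p = single A j k a :=
  ⟨_, V.column_eq (V.single_mem_Tl h a) fun _ hl i => single_apply_of_col_ne hl j i a⟩

variable (k)

open Classical in
/-- Left multiplication by `T` on the entries below the diagonal of the `k`-th column. -/
noncomputable def belowMul (T : BlockMatrix A) :
    BlockMatrix.Below A k →ₗ[ℝ] BlockMatrix.Below A k :=
  LinearMap.pi fun j => ∑ l : {l // k < l}, V.mul j l k (T j l) ∘ₗ LinearMap.proj l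

open Classical in
lemma belowMul_apply (T : BlockMatrix A) (v : BlockMatrix.Below A k) (j : {j // k < j}) :
    V.belowMul k T v j = ∑ l : {l // k < l}, V.mul j l k (T j l) (v l) := by
  simp [belowMul]

lemma prod_column {T : BlockMatrix A} (hT : T ∈ V.Tl) :
    V.prod T (V.column k p) = V.column k
      (V.diag k (T k k) * p.1, p.1 • (fun j : {j // k < j} => T j k) + V.belowMul k T p.2) := by
  classical
  have hcol : ∀ l ≠ k, ∀ i, V.prod T (V.column k p) i l = 0 := fun l hl i =>
    Finset.sum_eq_zero fun m _ => by rw [V.column_apply_of_ne k p hl, map_zero]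
  rw [← V.column_eq (V.prod_mem_Tl hT (V.column_mem_Tl k p)) hcol]
  congr 2
  · rw [V.diag_prod hT (V.column_mem_Tl k p), column_apply_self, LinearEquiv.apply_symm_apply]
  · funext j
    unfold prod
    rw [sum_univ_eq_add_sum_gt k fun i hi => by rw [V.column_mem_Tl k p i k hi, map_zero]]
    simp [belowMul_apply, V.mul_diag]

open Classical in
lemma det_belowMul [∀ i j, FiniteDimensional ℝ (A i j)] {T : BlockMatrix A} (hT : T ∈ V.Tl) :
    LinearMap.det (V.belowMul k T) =
      ∏ j : {j // k < j}, V.diag j (T j j) ^ Module.finrank ℝ (A j k) := by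
  refine det_pi_of_lowerTriangular _ (fun j : {j // k < j} => V.diag j (T j j)) ?_
  intro l x j hlj
  rw [belowMul_apply, Fintype.sum_eq_single l fun m hm => by rw [Pi.single_eq_of_ne hm, map_zero]]
  rcases eq_or_ne j l with rfl | hne
  · simp [V.diag_mul]
  · rw [hT j l fun h => hlj (h.lt_of_ne (Subtype.coe_ne_coe.2 hne.symm)), map_zero,
      LinearMap.zero_apply, Pi.single_eq_of_ne hne, smul_zero]

open Classical in
/-- The squared length of the part below the diagonal of the `k`-th column. -/
noncomputable def belowSq : QuadraticForm ℝ (BlockMatrix.Below A k) :=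
  QuadraticMap.pi fun j : {j // k < j} => V.entrySq j k

lemma tr_column_prod_adj :
    V.tr (V.prod (V.column k p) (V.adj (V.column k p))) = p.1 ^ 2 + V.belowSq k p.2 := by
  classical
  have hrow : ∀ i, ∑ j, V.entrySq i j (V.column k p i j) = V.entrySq i k (V.column k p i k) :=
    fun i => Fintype.sum_eq_single k fun l hl => by
      rw [V.column_apply_of_ne k p hl, QuadraticMap.map_zero]
  simp only [tr_prod_adj, hrow]
  rw [sum_univ_eq_add_sum_gt k fun i hi => by
    rw [V.column_mem_Tl k p i k hi, QuadraticMap.map_zero]]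
  simp [entrySq_diag, belowSq]

/-- The map `u ↦ u u^*` on the `k`-th columns. -/
noncomputable def columnSq : QuadraticMap ℝ (ℝ × BlockMatrix.Below A k) V.hermitian :=
  LinearMap.BilinMap.toQuadraticMap
    ((V.prodₗ.compl₁₂ (V.column k) (V.adjₗ ∘ₗ V.column k)).compr₂ V.hermPart)

end VinbergData

namespace VinbergAlgebra

variable (V : VinbergAlgebra I A) (k : I)

lemma belowSq_posDef : (V.belowSq k).PosDef := by
  classical
  exact QuadraticMap.posDef_pi_iff.2 fun j => V.entrySq_posDef j k

lemma coe_columnSq (p : ℝ × BlockMatrix.Below A k) :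
    (V.columnSq k p : BlockMatrix A) = V.prod (V.column k p) (V.adj (V.column k p)) :=
  congrArg Subtype.val (V.hermPart_of_mem (V.prod_adj_mem_hermitian (V.column k p)))

lemma polar_columnSq (p q : ℝ × BlockMatrix.Below A k) :
    QuadraticMap.polar (V.columnSq k) p q =
      (2 : ℝ) • V.hermPart (V.prod (V.column k p) (V.adj (V.column k q))) := by
  have hsymm : V.hermPart (V.prod (V.column k q) (V.adj (V.column k p))) =
      V.hermPart (V.prod (V.column k p) (V.adj (V.column k q))) := by
    rw [← V.hermPart_adj, V.adj_prod, V.adj_adj]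
  rw [VinbergData.columnSq, LinearMap.BilinMap.polar_toQuadraticMap, two_smul]
  exact congrArg _ hsymm

lemma hermPart_single_mem_span_columnSq {k j l : I} (hkl : k ≤ l) (hlj : l ≤ j) (a : A j l) :
    V.hermPart (single A j l a) ∈ Submodule.span ℝ (Set.range (V.columnSq k)) := by
  obtain ⟨v, hv⟩ : ∃ v : A l k, v ≠ 0 := by
    have : Nontrivial (A l k) := by
      rcases hkl.eq_or_lt with rfl | hlt
      · exact (V.diag k).toEquiv.nontrivial
      · exact Module.nontrivial_of_finrank_pos (V.finrank_pos l k hlt)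
    exact exists_ne 0
  obtain ⟨p, hp⟩ := V.exists_column_eq_single (hkl.trans hlj) (V.mul j l k a v)
  obtain ⟨q, hq⟩ := V.exists_column_eq_single hkl v
  have hprod : V.prod (V.column k p) (V.adj (V.column k q)) =
      V.entrySq l k v • single A j l a := by
    rw [hp, hq, V.adj_single, V.single_prod_single, V.mul_mul_star hlj hkl, map_smul]
  have hpolar := V.polar_columnSq k p q
  rw [hprod, map_smul, smul_smul] at hpolar
  rw [← Submodule.smul_mem_iff _ (mul_ne_zero two_ne_zero (V.entrySq_posDef l k v hv).ne'),
    ← hpolar]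
  have hmem : ∀ r, V.columnSq k r ∈ Submodule.span ℝ (Set.range (V.columnSq k)) :=
    fun r => Submodule.subset_span ⟨r, rfl⟩
  exact sub_mem (sub_mem (hmem _) (hmem _)) (hmem _)

lemma span_columnSq_eq_top :
    ⨆ (k : I) (_ : IsMin k), Submodule.span ℝ (Set.range (V.columnSq k)) = ⊤ := by
  set N := ⨆ (k : I) (_ : IsMin k), Submodule.span ℝ (Set.range (V.columnSq k))
  have hlower : ∀ {j l : I}, l ≤ j → ∀ a, V.hermPart (single A j l a) ∈ N := by
    intro j l hlj a
    obtain ⟨k, hkl, hk⟩ := Finite.exists_le_minimal (p := fun _ : I => True) (a := l) trivial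
    exact Submodule.mem_iSup_of_mem k <| Submodule.mem_iSup_of_mem (minimal_true.1 hk) <|
      V.hermPart_single_mem_span_columnSq hkl hlj a
  have hsingle : ∀ i j a, V.hermPart (single A i j a) ∈ N := by
    intro i j a
    by_cases hji : j ≤ i
    · exact hlower hji a
    by_cases hij : i ≤ j
    · rw [← V.hermPart_adj, V.adj_single]
      exact hlower hij _
    · have := V.subsingleton i j hij hji
      rw [Subsingleton.elim a 0, map_zero, map_zero]
      exact N.zero_mem
  rw [eq_top_iff]
  rintro Z -
  rw [← Subtype.coe_eta Z Z.2, ← V.hermPart_of_mem Z.2, ← BlockMatrix.sum_single Z.1]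
  simp only [map_sum]
  exact sum_mem fun i _ => sum_mem fun j _ => hsingle i j _

end VinbergAlgebra

end Columns

/-! ### The Gindikin–Wallach set -/

section Weights

namespace BlockMatrix

variable {I : Type*} [PartialOrder I] (A : I → I → Type*)
  [∀ i j, NormedAddCommGroup (A i j)] [∀ i j, NormedSpace ℝ (A i j)] (k : I) (α : ℝ)

open Classical in
/-- The contribution of the entries below the diagonal of the `k`-th column to the exponent of the
measure carried by this column. -/
noncomputable def columnShift (j : I) : ℝ :=
  if k < j then (Module.finrank ℝ (A j k) : ℝ) / 2 else 0

open Classical in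
/-- The exponent of the Riesz measure carried by the squares `u u^*`, `u` in the `k`-th column. -/
noncomputable def columnWeight : I → ℝ := Pi.single k α + columnShift A k

variable {k}

lemma columnShift_of_lt {j : I} (h : k < j) :
    columnShift A k j = (Module.finrank ℝ (A j k) : ℝ) / 2 := if_pos h

lemma columnShift_of_not_lt {j : I} (h : ¬ k < j) : columnShift A k j = 0 := if_neg h

lemma columnWeight_self : columnWeight A k α k = α := by
  simp [columnWeight, columnShift_of_not_lt]

lemma columnWeight_of_ne {j : I} (h : j ≠ k) : columnWeight A k α j = columnShift A k j := by
  simp [columnWeight, h]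

/-- The exponents of the convolutions of Riesz measures carried by columns. -/
def gindikinMonoid : AddSubmonoid (I → ℝ) :=
  AddSubmonoid.closure {χ | ∃ k α, 0 < α ∧ χ = columnWeight A k α}

variable {A}

lemma columnWeight_mem_gindikinMonoid (k : I) {α : ℝ} (hα : 0 < α) :
    columnWeight A k α ∈ gindikinMonoid A :=
  AddSubmonoid.subset_closure ⟨k, α, hα, rfl⟩

lemma exists_eq_columnWeight_add {k : I} (hk : IsMin k) {χ : I → ℝ}
    (hχ : χ ∈ gindikinMonoid A) (h : χ k ≠ 0) :
    ∃ α > 0, ∃ χ' ∈ gindikinMonoid A, χ = columnWeight A k α + χ' := by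
  induction hχ using AddSubmonoid.closure_induction with
  | mem χ hχ =>
    obtain ⟨l, α, hα, rfl⟩ := hχ
    obtain rfl : k = l := by
      by_contra hne
      exact h (by rw [columnWeight_of_ne A α hne, columnShift_of_not_lt A hk.not_lt])
    exact ⟨α, hα, 0, zero_mem _, (add_zero _).symm⟩
  | zero => exact absurd rfl h
  | add χ₁ χ₂ h₁ h₂ ih₁ ih₂ =>
    by_cases hz : χ₁ k = 0
    · obtain ⟨α, hα, χ', hχ', rfl⟩ := ih₂ (by simpa [hz] using h)
      exact ⟨α, hα, χ₁ + χ', add_mem h₁ hχ', add_left_comm _ _ _⟩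
    · obtain ⟨α, hα, χ', hχ', rfl⟩ := ih₁ hz
      exact ⟨α, hα, χ' + χ₂, add_mem hχ' h₂, add_assoc _ _ _⟩

end BlockMatrix

open BlockMatrix (columnShift columnWeight columnShift_of_lt columnShift_of_not_lt
  columnWeight_self columnWeight_of_ne gindikinMonoid columnWeight_mem_gindikinMonoid)

variable {I : Type*} [PartialOrder I] [Fintype I] {A : I → I → Type*}
  [∀ i j, NormedAddCommGroup (A i j)] [∀ i j, NormedSpace ℝ (A i j)]

namespace VinbergData

variable (V : VinbergData I A)

open Classical in
lemma prod_rpow_columnWeight (k : I) (α : ℝ) {T : BlockMatrix A} (hT : T ∈ V.TlPos) :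
    ∏ j, (V.diag j (T j j) ^ 2) ^ (-columnWeight A k α j) =
      (V.diag k (T k k) ^ 2) ^ (-α) *
        |(∏ j : {j // k < j}, V.diag j (T j j) ^ Module.finrank ℝ (A j k))⁻¹| := by
  have hbelow : ∀ j : {j // k < j}, (V.diag j (T j j) ^ 2) ^ (-columnWeight A k α j) =
      (V.diag j (T j j) ^ Module.finrank ℝ (A j k))⁻¹ := by
    intro j
    rw [columnWeight_of_ne A α j.2.ne', columnShift_of_lt A j.2, Real.rpow_neg (sq_nonneg _),
      ← Real.rpow_natCast, ← Real.rpow_natCast, ← Real.rpow_mul (hT.2 j).le, Nat.cast_ofNat,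
      mul_div_cancel₀ _ two_ne_zero]
  have hpos : 0 < ∏ j : {j // k < j}, V.diag j (T j j) ^ Module.finrank ℝ (A j k) :=
    Finset.prod_pos fun j _ => pow_pos (hT.2 j) _
  rw [abs_of_pos (inv_pos.2 hpos), ← Finset.prod_inv_distrib, prod_univ_eq_mul_prod_gt k,
    columnWeight_self, Finset.prod_congr rfl fun j _ => hbelow j]
  intro j hj
  rw [columnWeight_of_ne A α fun h => hj h.ge, columnShift_of_not_lt A fun h => hj h.le, neg_zero,
    Real.rpow_zero]

end VinbergData

namespace VinbergAlgebra

variable (V : VinbergAlgebra I A) {i : I} {ψ : I → Fin 2}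

open Classical in
lemma nPsi_div_two (j : I) : V.nPsi ψ j / 2 = ∑ k with ψ k = 1, columnShift A k j := by
  rw [nPsi, Finset.sum_div, Finset.sum_filter, Finset.sum_filter]
  refine Finset.sum_congr rfl fun k _ => ?_
  have : ψ k = 0 ∨ ψ k = 1 := by omega
  rcases this with h | h <;> simp [h, columnShift]

lemma nPsi_of_not_le (hψ : ∀ j, ¬ i ≤ j → ψ j = 0) {j : I} (hj : ¬ i ≤ j) : V.nPsi ψ j = 0 := by
  classical
  refine Finset.sum_eq_zero fun k hk => ?_
  rw [hψ k fun hik => hj (hik.trans (Finset.mem_filter.1 hk).2.le)]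
  simp

open Classical in
lemma eq_sum_columnWeight_of_mem_XiPsi (hψ : ∀ j, ¬ i ≤ j → ψ j = 0) {χ : I → ℝ}
    (hχ : χ ∈ V.XiPsi i ψ) :
    χ = ∑ k with ψ k = 1, columnWeight A k (χ k - V.nPsi ψ k / 2) := by
  obtain ⟨hzero, hboundary, -⟩ := hχ
  funext j
  simp only [columnWeight, Finset.sum_apply, Pi.add_apply, Finset.sum_add_distrib,
    ← V.nPsi_div_two, Finset.sum_pi_single, Finset.mem_filter_univ]
  split_ifs with hj
  · rw [sub_add_cancel]
  · rw [zero_add]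
    by_cases hij : i ≤ j
    · exact hboundary j hij (by omega)
    · rw [hzero j hij, V.nPsi_of_not_le hψ hij, zero_div]

lemma mem_gindikinMonoid_of_mem_XiPsi (hψ : ∀ j, ¬ i ≤ j → ψ j = 0) {χ : I → ℝ}
    (hχ : χ ∈ V.XiPsi i ψ) : χ ∈ gindikinMonoid A := by
  classical
  rw [V.eq_sum_columnWeight_of_mem_XiPsi hψ hχ]
  refine sum_mem fun k hk => columnWeight_mem_gindikinMonoid k (sub_pos.2 ?_)
  have hk1 : ψ k = 1 := (Finset.mem_filter.1 hk).2
  have hik : i ≤ k := by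
    by_contra hik
    simp [hψ k hik] at hk1
  exact hχ.2.2 k hik hk1

lemma mem_gindikinMonoid_of_mem_Xi {χ : I → ℝ} (hχ : χ ∈ V.Xi) : χ ∈ gindikinMonoid A := by
  obtain ⟨c, hc, hc0, rfl⟩ := hχ
  refine sum_mem fun i _ => ?_
  by_cases hi : i ∈ initialSet I ∪ separatorSet I
  · obtain ⟨ψ, hψ, h⟩ := Set.mem_iUnion₂.1 (hc i hi)
    exact V.mem_gindikinMonoid_of_mem_XiPsi hψ.1 h
  · rw [hc0 i hi]
    exact zero_mem _

end VinbergAlgebra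

end Weights

/-! ### The dual cone near the unit -/

section TraceForm

variable {I : Type*} [PartialOrder I] [Fintype I] {A : I → I → Type*}
  [∀ i j, NormedAddCommGroup (A i j)] [∀ i j, NormedSpace ℝ (A i j)]

namespace VinbergData

variable (V : VinbergData I A)

/-- The pairing `(θ, Z) ↦ tr (θ Z)`. -/
def trForm : BlockMatrix A →ₗ[ℝ] V.hermitian →ₗ[ℝ] ℝ :=
  (V.prodₗ.compr₂ V.trₗ).compl₂ V.hermitian.subtype

lemma trForm_apply (θ : BlockMatrix A) (Z : V.hermitian) : V.trForm θ Z = V.tr (V.prod θ Z) := rfl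

variable [∀ i j, FiniteDimensional ℝ (A i j)]

open Topology in
lemma map_adj_prod_nhds_one :
    Filter.map (fun T : V.lowerTri => V.hermPart (V.prod (V.adj T) T)) (𝓝 ⟨_, V.one_mem_TlPos.1⟩) =
      𝓝 ⟨V.one, V.one_mem_hermitian⟩ := by
  let e : V.lowerTri := ⟨_, V.one_mem_TlPos.1⟩
  let B : V.lowerTri →ₗ[ℝ] V.lowerTri →ₗ[ℝ] V.hermitian :=
    (V.prodₗ.compl₁₂ (V.adjₗ ∘ₗ V.lowerTri.subtype) V.lowerTri.subtype).compr₂ V.hermPart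
  have hderiv := B.toContinuousBilinearMap.hasStrictFDerivAt_of_bilinear
    (hasStrictFDerivAt_id e) (hasStrictFDerivAt_id e)
  have hmap := hderiv.map_nhds_eq_of_surj <| by
    rw [LinearMap.range_eq_top]
    intro H
    obtain ⟨T, hT, hTH⟩ := V.exists_lowerTri_add_adj H.2
    refine ⟨⟨T, hT⟩, ?_⟩
    change V.hermPart (V.prod (V.adj V.one) T) + V.hermPart (V.prod (V.adj T) V.one) = H
    rw [V.adj_one, V.one_prod, V.prod_one, ← map_add, hTH, V.hermPart_of_mem H.2]
  refine hmap.trans (congrArg 𝓝 ?_)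
  change V.hermPart (V.prod (V.adj V.one) V.one) = _
  rw [V.adj_one, V.one_prod, V.hermPart_of_mem V.one_mem_hermitian]

end VinbergData

namespace VinbergAlgebra

variable (V : VinbergAlgebra I A)

lemma trForm_self_pos {η : V.hermitian} (h : η ≠ 0) : 0 < V.trForm η η := by
  have hpos := V.tr_self_pos η fun h0 => h (Subtype.ext h0)
  rwa [V.mem_hermitian.1 η.2] at hpos

variable [∀ i j, FiniteDimensional ℝ (A i j)]

lemma exists_trForm_eq (f : V.hermitian →ₗ[ℝ] ℝ) : ∃ η : V.hermitian, V.trForm η = f := by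
  let Φ : V.hermitian →ₗ[ℝ] Module.Dual ℝ V.hermitian := V.trForm ∘ₗ V.hermitian.subtype
  have hinj : Function.Injective Φ := (injective_iff_map_eq_zero Φ).2 fun η hη => by
    by_contra h
    exact (V.trForm_self_pos h).ne' (LinearMap.congr_fun hη η)
  exact (LinearMap.injective_iff_surjective_of_finrank_eq_finrank
    Subspace.dual_finrank_eq.symm).1 hinj f

open Topology in
lemma eventually_mem_dualCone :
    ∀ᶠ θ : V.hermitian in 𝓝 ⟨V.one, V.one_mem_hermitian⟩, (θ : BlockMatrix A) ∈ V.dualCone := by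
  rw [← V.map_adj_prod_nhds_one, Filter.eventually_map]
  have hpos : ∀ i, ∀ᶠ T : V.lowerTri in 𝓝 ⟨V.one, V.one_mem_TlPos.1⟩, 0 < V.diag i (T.1 i i) := by
    intro i
    have hdiag : Continuous (V.diag i) :=
      LinearMap.continuous_of_finiteDimensional (V.diag i).toLinearMap
    have hentry : Continuous fun T : V.lowerTri => T.1 i i :=
      (continuous_apply_apply i i).comp continuous_subtype_val
    exact (hdiag.comp hentry).continuousAt.eventually (lt_mem_nhds (V.one_mem_TlPos.2 i))
  filter_upwards [Filter.eventually_all.2 hpos] with T hT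
  exact ⟨T, ⟨T.2, hT⟩, by rw [V.hermPart_of_mem (V.adj_prod_mem_hermitian T)]⟩

open Topology in
lemma exists_one_add_sub_smul_mem_dualCone (η : V.hermitian) :
    ∃ s : ℝ, s ≠ 0 ∧ V.one + s • (η : BlockMatrix A) ∈ V.dualCone ∧
      V.one + (-s) • (η : BlockMatrix A) ∈ V.dualCone := by
  let e : V.hermitian := ⟨V.one, V.one_mem_hermitian⟩
  have hcont : Continuous fun s : ℝ => e + s • η := by fun_prop
  have hnhds : ∀ᶠ s in 𝓝 (0 : ℝ), V.one + s • (η : BlockMatrix A) ∈ V.dualCone :=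
    (by simpa using hcont.tendsto 0 : Filter.Tendsto _ _ (𝓝 e)).eventually V.eventually_mem_dualCone
  have hneg : ∀ᶠ s in 𝓝 (0 : ℝ), V.one + (-s) • (η : BlockMatrix A) ∈ V.dualCone :=
    (continuous_neg.tendsto' 0 0 neg_zero).eventually hnhds
  obtain ⟨s, hs, hs0⟩ := (((hnhds.and hneg).filter_mono nhdsWithin_le_nhds).and
    (self_mem_nhdsWithin : {(0 : ℝ)}ᶜ ∈ 𝓝[≠] 0)).exists
  exact ⟨s, hs0, hs⟩

end VinbergAlgebra

end TraceForm

/-! ### Diagonal matrix units -/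

section DiagUnit

open BlockMatrix (single single_apply_same single_apply_of_row_ne)

variable {I : Type*} [PartialOrder I] {A : I → I → Type*}
  [∀ i j, NormedAddCommGroup (A i j)] [∀ i j, NormedSpace ℝ (A i j)]

namespace VinbergData

variable (V : VinbergData I A) (i : I)

/-- The `i`-th diagonal matrix unit. -/
noncomputable def diagUnit : V.hermitian :=
  ⟨single A i i ((V.diag i).symm 1), by rw [V.mem_hermitian, V.adj_single, V.star_diag]⟩

lemma diagUnit_apply_self : (V.diagUnit i).1 i i = (V.diag i).symm 1 := single_apply_same ..

variable {i} in
lemma diagUnit_apply_of_ne {j : I} (h : j ≠ i) : (V.diagUnit i).1 j j = 0 :=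
  single_apply_of_row_ne h ..

lemma diagUnit_ne_zero : V.diagUnit i ≠ 0 := fun h => by
  simpa [V.diagUnit_apply_self] using congrFun (congrFun (congrArg Subtype.val h) i) i

lemma diag_one_add_smul_diagUnit [DecidableEq I] (t : ℝ) (j : I) :
    V.diag j ((V.one + t • (V.diagUnit i).1) j j) = if j = i then 1 + t else 1 := by
  rw [Pi.add_apply, Pi.add_apply, Pi.smul_apply, Pi.smul_apply, V.one_apply_self]
  split_ifs with h
  · subst h
    simp [V.diagUnit_apply_self]
  · simp [V.diagUnit_apply_of_ne h]

lemma one_add_smul_diagUnit_mem_TlPos {t : ℝ} (ht : -1 < t) :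
    V.one + t • (V.diagUnit i).1 ∈ V.TlPos := by
  classical
  refine ⟨V.lowerTri.add_mem V.one_mem_TlPos.1
    (V.lowerTri.smul_mem t (V.single_mem_Tl le_rfl _)), fun j => ?_⟩
  rw [V.diag_one_add_smul_diagUnit]
  split_ifs
  · linarith
  · exact one_pos

variable [Fintype I]

lemma diagUnit_prod_diagUnit :
    V.prod (V.diagUnit i) (V.diagUnit i) = (V.diagUnit i : BlockMatrix A) := by
  rw [diagUnit, V.single_prod_single, V.diag_mul, LinearEquiv.apply_symm_apply, one_smul]

lemma adj_prod_one_add_smul_diagUnit (t : ℝ) :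
    V.prod (V.adj (V.one + t • (V.diagUnit i).1)) (V.one + t • (V.diagUnit i).1) =
      V.one + ((1 + t) ^ 2 - 1) • (V.diagUnit i).1 := by
  have hherm : V.adj (V.one + t • (V.diagUnit i).1) = V.one + t • (V.diagUnit i).1 :=
    add_mem V.one_mem_hermitian (V.hermitian.smul_mem t (V.diagUnit i).2)
  rw [hherm, V.add_prod, V.one_prod, V.prod_add, V.prod_one, ← V.prodₗ_apply, map_smul, map_smul,
    LinearMap.smul_apply, V.prodₗ_apply, V.diagUnit_prod_diagUnit]
  module

end VinbergData

end DiagUnit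

/-! ### Riesz measures -/

section RieszMeasure

open BlockMatrix (Below columnWeight gindikinMonoid exists_eq_columnWeight_add)

variable {I : Type*} [PartialOrder I] [Fintype I] {A : I → I → Type*}
  [∀ i j, NormedAddCommGroup (A i j)] [∀ i j, NormedSpace ℝ (A i j)]
  [∀ i j, FiniteDimensional ℝ (A i j)] [∀ i j, MeasurableSpace (A i j)]

namespace VinbergAlgebra

variable (V : VinbergAlgebra I A) {χ χ' : I → ℝ} {μ ν : Measure V.hermitian}

lemma isRieszMeasure_iff :
    V.IsRieszMeasure χ μ ↔ ∀ T ∈ V.TlPos, V.laplace μ (V.prod (V.adj T) T) =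
      ENNReal.ofReal (∏ k, (V.diag k (T k k) ^ 2) ^ (-χ k)) := by
  constructor
  · intro h T hT
    rw [h _ ⟨T, hT, rfl⟩, V.genPower_dualInv χ hT]
  · rintro h _ ⟨T, hT, rfl⟩
    rw [h T hT, V.genPower_dualInv χ hT]

namespace IsRieszMeasure

variable {V}

lemma laplace_one (hμ : V.IsRieszMeasure χ μ) : V.laplace μ V.one = 1 := by
  have h := V.isRieszMeasure_iff.1 hμ V.one V.one_mem_TlPos
  simpa [V.one_apply_self] using h

lemma ne_zero (hμ : V.IsRieszMeasure χ μ) : μ ≠ 0 := by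
  rintro rfl
  simpa [laplace] using hμ.laplace_one

lemma laplace_one_add_smul_diagUnit (hμ : V.IsRieszMeasure χ μ) (i : I) {s : ℝ} (hs : -1 < s) :
    V.laplace μ (V.one + s • (V.diagUnit i).1) = ENNReal.ofReal ((1 + s) ^ (-χ i)) := by
  classical
  have hpos : 0 < 1 + s := by linarith
  have ht : -1 < √(1 + s) - 1 := by linarith [Real.sqrt_pos.2 hpos]
  have hsq : (1 + (√(1 + s) - 1)) ^ 2 = 1 + s := by
    rw [add_sub_cancel, Real.sq_sqrt hpos.le]
  have hprod := V.adj_prod_one_add_smul_diagUnit i (√(1 + s) - 1)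
  rw [hsq, add_sub_cancel_left] at hprod
  rw [← hprod, V.isRieszMeasure_iff.1 hμ _ (V.one_add_smul_diagUnit_mem_TlPos i ht),
    Fintype.prod_eq_single i fun j hj => ?_]
  · rw [V.diag_one_add_smul_diagUnit, if_pos rfl, hsq]
  · rw [V.diag_one_add_smul_diagUnit, if_neg hj, one_pow, Real.one_rpow]

end IsRieszMeasure

variable [∀ i j, BorelSpace (A i j)]

lemma measurable_trForm (θ : BlockMatrix A) : Measurable (V.trForm θ) :=
  (LinearMap.continuous_of_finiteDimensional (V.trForm θ)).measurable

lemma measurable_laplace_integrand (θ : BlockMatrix A) :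
    Measurable fun Z : V.hermitian => ENNReal.ofReal (Real.exp (-V.tr (V.prod θ Z))) :=
  (V.measurable_trForm θ).neg.exp.ennreal_ofReal

lemma laplace_conv (μ ν : Measure V.hermitian) [SFinite ν] (θ : BlockMatrix A) :
    V.laplace (μ ∗ ν) θ = V.laplace μ θ * V.laplace ν θ := by
  have hmeas := V.measurable_laplace_integrand θ
  unfold laplace
  rw [Measure.lintegral_conv hmeas, ← lintegral_mul_const _ hmeas]
  refine lintegral_congr fun X => ?_
  rw [← lintegral_const_mul _ hmeas]
  refine lintegral_congr fun Y => ?_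
  rw [← ENNReal.ofReal_mul (Real.exp_pos _).le, ← Real.exp_add, ← neg_add]
  simp only [← V.trForm_apply, map_add]

lemma isRieszMeasure_dirac_zero : V.IsRieszMeasure 0 (Measure.dirac 0) := by
  refine V.isRieszMeasure_iff.2 fun T _ => ?_
  rw [laplace, lintegral_dirac' _ (V.measurable_laplace_integrand _), ← V.trForm_apply, map_zero]
  simp

lemma IsRieszMeasure.conv {V : VinbergAlgebra I A} {μ ν : Measure V.hermitian} [SFinite ν]
    (hμ : V.IsRieszMeasure χ μ) (hν : V.IsRieszMeasure χ' ν) :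
    V.IsRieszMeasure (χ + χ') (μ ∗ ν) := by
  rw [isRieszMeasure_iff] at *
  intro T hT
  rw [laplace_conv, hμ T hT, hν T hT, ← ENNReal.ofReal_mul
    (Finset.prod_nonneg fun k _ => Real.rpow_nonneg (sq_nonneg _) _), ← Finset.prod_mul_distrib]
  congr 1
  refine Finset.prod_congr rfl fun k _ => ?_
  rw [← Real.rpow_add (pow_pos (hT.2 k) 2), Pi.add_apply, neg_add]

section Column

variable (k : I) (α : ℝ)

open Classical in
/-- The image under `u ↦ u u^*` of the measure on the `k`-th columns that is Lebesgue below the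
diagonal and has the density `r ^ (2 α - 1)` on the diagonal. -/
noncomputable def columnMeasure : Measure V.hermitian :=
  ((radialMeasure α).prod Measure.addHaar).map (V.columnSq k)

instance : SFinite (V.columnMeasure k α) := by unfold columnMeasure; infer_instance

open Classical in
/-- The total mass of `e^{-tr Z}` under `columnMeasure`, the normalizing constant of the Riesz
measure. -/
noncomputable def columnMass : ENNReal :=
  ENNReal.ofReal (Real.Gamma α / 2) *
    ∫⁻ v, ENNReal.ofReal (Real.exp (-V.belowSq k v)) ∂Measure.addHaar

lemma columnMass_ne_top : V.columnMass k α ≠ ⊤ := by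
  classical
  rw [columnMass]
  exact ENNReal.mul_ne_top ENNReal.ofReal_ne_top
    (lintegral_exp_neg_quadraticForm_lt_top Measure.addHaar (V.belowSq_posDef k)).ne

variable {α}

lemma columnMass_ne_zero (hα : 0 < α) : V.columnMass k α ≠ 0 := by
  classical
  have hmeas : Measurable fun v => ENNReal.ofReal (Real.exp (-V.belowSq k v)) :=
    (continuous_quadraticMap (V.belowSq k)).measurable.neg.exp.ennreal_ofReal
  refine mul_ne_zero (by simpa using Real.Gamma_pos_of_pos hα) fun h => ?_
  obtain ⟨v, hv⟩ := ((lintegral_eq_zero_iff hmeas).1 h).exists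
  exact (ENNReal.ofReal_pos.2 (Real.exp_pos _)).ne' hv

lemma laplace_columnMeasure (hα : 0 < α) {T : BlockMatrix A} (hT : T ∈ V.TlPos) :
    V.laplace (V.columnMeasure k α) (V.prod (V.adj T) T) =
      ENNReal.ofReal (∏ j, (V.diag j (T j j) ^ 2) ^ (-columnWeight A k α j)) *
        V.columnMass k α := by
  classical
  have hdet : LinearMap.det (V.belowMul k T) ≠ 0 := by
    rw [V.det_belowMul k hT.1]
    exact Finset.prod_ne_zero_iff.2 fun j _ => pow_ne_zero _ (hT.2 j).ne'
  have hcol : ∀ p : ℝ × Below A k, V.tr (V.prod (V.prod (V.adj T) T) (V.columnSq k p)) =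
      V.diag k (T k k) ^ 2 * p.1 ^ 2 +
        V.belowSq k (p.1 • (fun j : {j // k < j} => T j k) + V.belowMul k T p.2) := by
    intro p
    rw [coe_columnSq, V.tr_adj_prod_prod hT.1 (V.column_mem_Tl k p), V.prod_column k p hT.1,
      V.tr_column_prod_adj, mul_pow]
  have hmeas : Measurable fun v => ENNReal.ofReal (Real.exp (-V.belowSq k v)) :=
    (continuous_quadraticMap (V.belowSq k)).measurable.neg.exp.ennreal_ofReal
  rw [laplace, columnMeasure, lintegral_map (V.measurable_laplace_integrand _)
    (continuous_quadraticMap (V.columnSq k)).measurable, V.prod_rpow_columnWeight k α hT,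
    ← V.det_belowMul k hT.1, ENNReal.ofReal_mul (Real.rpow_nonneg (sq_nonneg _) _), columnMass,
    ← lintegral_radialMeasure_prod _ hmeas hα (pow_pos (hT.2 k) 2) (fun j => T j k) hdet]
  refine lintegral_congr fun p => ?_
  rw [hcol, neg_add, Real.exp_add, ENNReal.ofReal_mul (Real.exp_pos _).le]

lemma isRieszMeasure_columnWeight (hα : 0 < α) :
    V.IsRieszMeasure (columnWeight A k α) ((V.columnMass k α)⁻¹ • V.columnMeasure k α) := by
  refine V.isRieszMeasure_iff.2 fun T hT => ?_
  rw [laplace, lintegral_smul_measure, ← laplace, V.laplace_columnMeasure k hα hT, smul_eq_mul,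
    mul_left_comm, ENNReal.inv_mul_cancel (V.columnMass_ne_zero k hα) (V.columnMass_ne_top k α),
    mul_one]

lemma map_columnSq_eq_zero_of_ae_columnMeasure {f : V.hermitian →ₗ[ℝ] ℝ} {b : ℝ}
    (h : ∀ᵐ Z ∂V.columnMeasure k α, f Z = b) (p : ℝ × Below A k) : f (V.columnSq k p) = 0 := by
  classical
  have hf : Measurable f := (LinearMap.continuous_of_finiteDimensional f).measurable
  rw [columnMeasure, ae_map_iff (continuous_quadraticMap (V.columnSq k)).aemeasurable
    (measurableSet_eq_fun hf measurable_const)] at h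
  exact DFunLike.congr_fun (quadraticForm_eq_zero_of_ae_const_radialMeasure_prod Measure.addHaar
    (Q := f.compQuadraticMap (V.columnSq k)) h) p

end Column

lemma exists_isRieszMeasure (hχ : χ ∈ gindikinMonoid A) :
    ∃ R : Measure V.hermitian, SFinite R ∧ V.IsRieszMeasure χ R := by
  induction hχ using AddSubmonoid.closure_induction with
  | mem χ hχ =>
    obtain ⟨k, α, hα, rfl⟩ := hχ
    exact ⟨_, inferInstance, V.isRieszMeasure_columnWeight k hα⟩
  | zero => exact ⟨_, inferInstance, V.isRieszMeasure_dirac_zero⟩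
  | add χ₁ χ₂ _ _ ih₁ ih₂ =>
    obtain ⟨R₁, _, hR₁⟩ := ih₁
    obtain ⟨R₂, _, hR₂⟩ := ih₂
    exact ⟨R₁ ∗ R₂, inferInstance, hR₁.conv hR₂⟩

lemma lintegral_exp_neg_trForm_add (μ : Measure V.hermitian) (η : BlockMatrix A) (s c : ℝ) :
    ∫⁻ Z, ENNReal.ofReal (Real.exp (-V.trForm V.one Z + s * (c - V.trForm η Z))) ∂μ =
      ENNReal.ofReal (Real.exp (s * c)) * V.laplace μ (V.one + s • η) := by
  rw [laplace, ← lintegral_const_mul _ (V.measurable_laplace_integrand _)]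
  refine lintegral_congr fun Z => ?_
  rw [← ENNReal.ofReal_mul (Real.exp_pos _).le, ← Real.exp_add, ← V.trForm_apply, map_add,
    map_smul, LinearMap.add_apply, LinearMap.smul_apply, smul_eq_mul]
  ring_nf

namespace IsRieszMeasure

variable {V}

lemma ae_eq_of_laplace_eq (hμ : V.IsRieszMeasure χ μ) {η : BlockMatrix A} {s c : ℝ} (hs : s ≠ 0)
    (hadd : ENNReal.ofReal (Real.exp (s * c)) * V.laplace μ (V.one + s • η) = 1)
    (hsub : ENNReal.ofReal (Real.exp (-s * c)) * V.laplace μ (V.one + (-s) • η) = 1) :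
    ∀ᵐ Z ∂μ, V.trForm η Z = c := by
  have hmeas := V.measurable_trForm
  have hone : ∫⁻ Z, ENNReal.ofReal (Real.exp (-V.trForm V.one Z)) ∂μ = 1 := hμ.laplace_one
  have hzero := ae_eq_zero_of_lintegral_exp_add_sub (μ := μ)
    (f := fun Z => s * (c - V.trForm η Z)) (g := fun Z => -V.trForm V.one Z)
    (by fun_prop) (by fun_prop) (by rw [hone]; exact ENNReal.one_ne_top)
    (by rw [V.lintegral_exp_neg_trForm_add, hadd, hone])
    (by simp_rw [sub_eq_add_neg (-V.trForm V.one _), ← neg_mul]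
        rw [V.lintegral_exp_neg_trForm_add, hsub, hone])
  filter_upwards [hzero] with Z hZ
  exact (sub_eq_zero.1 ((mul_eq_zero.1 hZ).resolve_left hs)).symm

lemma ae_eq_const (hμ : V.IsRieszMeasure χ μ) (hν : V.IsRieszMeasure χ ν)
    {f : V.hermitian →ₗ[ℝ] ℝ} {c : ℝ} (h : ∀ᵐ Z ∂μ, f Z = c) : ∀ᵐ Z ∂ν, f Z = c := by
  obtain ⟨η, rfl⟩ := V.exists_trForm_eq f
  have hline : ∀ s : ℝ, V.one + s • (η : BlockMatrix A) ∈ V.dualCone →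
      ENNReal.ofReal (Real.exp (s * c)) * V.laplace ν (V.one + s • (η : BlockMatrix A)) = 1 := by
    intro s hs
    rw [hν _ hs, ← hμ _ hs, ← V.lintegral_exp_neg_trForm_add, ← hμ.laplace_one]
    refine lintegral_congr_ae (h.mono fun Z hZ => ?_)
    beta_reduce
    rw [hZ, sub_self, mul_zero, add_zero, V.trForm_apply]
  obtain ⟨s, hs, hadd, hsub⟩ := V.exists_one_add_sub_smul_mem_dualCone η
  exact hν.ae_eq_of_laplace_eq hs (hline s hadd) (hline (-s) hsub)

lemma ne_zero_of_generatesNEF (hμ : V.IsRieszMeasure χ μ) (hN : V.GeneratesNEF μ) (i : I) :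
    χ i ≠ 0 := by
  intro hi
  have hline : ∀ s : ℝ, -1 < s → ENNReal.ofReal (Real.exp (s * 0)) *
      V.laplace μ (V.one + s • (V.diagUnit i).1) = 1 := by
    intro s hs
    rw [hμ.laplace_one_add_smul_diagUnit i hs, hi]
    simp
  have hae : ∀ᵐ Z ∂μ, V.trForm (V.diagUnit i) Z = 0 :=
    hμ.ae_eq_of_laplace_eq (s := 1 / 2) (by norm_num) (hline _ (by norm_num))
      (hline _ (by norm_num))
  have hne : V.trForm (V.diagUnit i) ≠ 0 := fun h =>
    (V.trForm_self_pos (V.diagUnit_ne_zero i)).ne' (by rw [h, LinearMap.zero_apply])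
  exact hN.1 _ 0 hne hae

lemma map_columnSq_eq_zero_of_ae_const (hμ : V.IsRieszMeasure χ μ) (hχ : χ ∈ gindikinMonoid A)
    {k : I} (hk : IsMin k) (hχk : χ k ≠ 0) {f : V.hermitian →ₗ[ℝ] ℝ} {c : ℝ}
    (h : ∀ᵐ Z ∂μ, f Z = c) (p : ℝ × Below A k) : f (V.columnSq k p) = 0 := by
  obtain ⟨α, hα, χ', hχ', rfl⟩ := exists_eq_columnWeight_add hk hχ hχk
  obtain ⟨ν, _, hν⟩ := V.exists_isRieszMeasure hχ'
  have hconv := hμ.ae_eq_const ((V.isRieszMeasure_columnWeight k hα).conv hν) h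
  obtain ⟨b, hb⟩ := exists_ae_eq_const_of_ae_conv hν.ne_zero (f := f.toAddMonoidHom)
    (LinearMap.continuous_of_finiteDimensional f).measurable hconv
  rw [Measure.ae_ennreal_smul_measure_iff (ENNReal.inv_ne_zero.2 (V.columnMass_ne_top k α))] at hb
  exact V.map_columnSq_eq_zero_of_ae_columnMeasure k hb p

lemma generatesNEF (hμ : V.IsRieszMeasure χ μ) (hχ : χ ∈ gindikinMonoid A)
    (hmin : ∀ i, IsMin i → χ i ≠ 0) : V.GeneratesNEF μ := by
  constructor
  · intro f c hf hae
    refine hf (LinearMap.ker_eq_top.1 (top_le_iff.1 ?_))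
    rw [← V.span_columnSq_eq_top]
    refine iSup₂_le fun k hk => Submodule.span_le.2 ?_
    rintro _ ⟨p, rfl⟩
    exact hμ.map_columnSq_eq_zero_of_ae_const hχ hk (hmin k hk) hae p
  · refine ⟨⟨V.one, V.one_mem_hermitian⟩, mem_interior_iff_mem_nhds.2 ?_⟩
    filter_upwards [V.eventually_mem_dualCone] with θ hθ
    rw [hμ θ hθ]
    exact ENNReal.ofReal_lt_top

end IsRieszMeasure

end VinbergAlgebra

end RieszMeasure

lemma mem_initialSet_of_isMin {I : Type*} [PartialOrder I] (hI : ∀ i : I, ∃ j, i < j ∨ j < i)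
    {i : I} (hi : IsMin i) : i ∈ initialSet I :=
  ⟨(hI i).imp fun _ h => h.resolve_right hi.not_lt, fun ⟨_, h⟩ => hi.not_lt h⟩

theorem theorem4p1_general {I : Type*} [PartialOrder I] [Fintype I] {A : I → I → Type*}
    [∀ i j, NormedAddCommGroup (A i j)] [∀ i j, NormedSpace ℝ (A i j)]
    [∀ i j, FiniteDimensional ℝ (A i j)]
    [∀ i j, MeasurableSpace (A i j)] [∀ i j, BorelSpace (A i j)]
    (V : VinbergAlgebra I A) (χ : I → ℝ) (hχ : χ ∈ BlockMatrix.gindikinMonoid A) :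
    (∃ R : Measure V.hermitian, V.IsRieszMeasure χ R) ∧
      ∀ R : Measure V.hermitian, V.IsRieszMeasure χ R →
        List.TFAE [V.GeneratesNEF R, ∀ i, χ i ≠ 0, ∀ i, IsMin i → χ i ≠ 0] := by
  refine ⟨(V.exists_isRieszMeasure hχ).imp fun _ => And.right, fun R hR => ?_⟩
  tfae_have 1 → 2 := hR.ne_zero_of_generatesNEF
  tfae_have 2 → 3 := fun h i _ => h i
  tfae_have 3 → 1 := hR.generatesNEF hχ
  tfae_finish

theorem theorem4p1 {I : Type*} [PartialOrder I] [Fintype I] {A : I → I → Type*}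
    [∀ i j, NormedAddCommGroup (A i j)] [∀ i j, NormedSpace ℝ (A i j)]
    [∀ i j, FiniteDimensional ℝ (A i j)]
    [∀ i j, MeasurableSpace (A i j)] [∀ i j, BorelSpace (A i j)]
    (V : VinbergAlgebra I A)
    (hI : ∀ i : I, ∃ j, i < j ∨ j < i)
    (χ : I → ℝ) (hχ : χ ∈ V.Xi) :
    (∃ R : Measure V.hermitian, V.IsRieszMeasure χ R) ∧
      ∀ R : Measure V.hermitian, V.IsRieszMeasure χ R →
        (V.GeneratesNEF R ↔ ∀ i ∈ initialSet I ∪ separatorSet I, χ i ≠ 0) := by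
  obtain ⟨hex, htfae⟩ := theorem4p1_general V χ (V.mem_gindikinMonoid_of_mem_Xi hχ)
  refine ⟨hex, fun R hR => ⟨fun hN i _ => ?_, fun h => ((htfae R hR).out 2 0).1 fun i hi => ?_⟩⟩
  · have hall : ∀ i, χ i ≠ 0 := ((htfae R hR).out 0 1).1 hN
    exact hall i
  · exact h i (Or.inl (mem_initialSet_of_isMin hI hi))
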